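/- Conventions. Let $K$ be a field of characteristic exponent $p$ ($p=\operatorname{char}K$ if this is positive, $p=1$ otherwise). - A field extension $F/E$ of characteristic exponent $p$ is separable if $F$ is linearly disjoint over $E$ from $E^{1/p}=\{x\in F^{\mathrm{alg}} : x^p\in E\}$. A tuple $b$ is separable over $E$ if $E(b)/E$ is. - For a subfield $D$ of a field $F$, a set $A\subseteq F$ is $p$-independent in $F$ over $D$ if $x\notin F^{(p)}D(A\setminus\{x\})$ for all $x\in A$, where $F^{(p)}=\{y^p : y\in F\}$. A $p$-basis of $F$ is a set $A$ that is $p$-independent over the prime field and satisfies $F=F^{(p)}(A)$. - For a well-ordered $p$-independent set $d=(d_j)_{j\in J}$ of $K$ and $x\in K^{(p)}(d)$, the elements $\lambda^d_I(x)\in K$ are the unique (finitely supported) family with $x=\sum_I d^I\lambda^d_I(x)^p$, where $I$ ranges over the finitely supported multi-indices $I\in\{0,\dots,p-1\}^J$ and $d^I=\prod_j d_j^{I_j}$. For a set $B\subseteq K^{(p)}(d)$ put $\lambda^d(B)=\{\lambda^d_I(x) : x\in B,\ I\}$; for finite well-ordered $B$ it is finite, and it is ordered lexicographically by $(x,I)$.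 - Let $C\subseteq K$ be a subfield with $K/C$ separable, $c$ a well-ordered $p$-basis of $C$, and $a\in K^m$, $b\in K^n$. Define pairs of finite ordered subsets of $K$ by $(A_0,B_0)=(\emptyset,a)$, and: $A_{k+1}$ is the concatenation of $A_k$ with the maximal subset of $B_k$ that is $p$-independent in $K$ over $C(A_k)$, chosen greedily from the left; $B_{k+1}$ is the concatenation of $B_k$ with $\lambda^{cA_{k+1}}(B_k)$, where $cA_{k+1}$ is the concatenation of $c$ and $A_{k+1}$. Let $k$ be minimal such that $b$ is separable over $C(A_k\cup B_k)$, and put $\lambda_{K/b/c}a=A_k\cup B_k$, a finite tuple of distinct elements, of length $\ell$ say. It contains every $a_i$; let $\sigma_{K/b/c}:K^\ell\to K^m$ be the coordinate projection that maps $\lambda_{K/b/c}a$ to $a$. - For $e\in K^\ell$, $\operatorname{locus}(e/C)(K)$ is the set of $y\in K^\ell$ such that $f(y)=0$ for all $f\in C[X_1,\dots,X_\ell]$ with $f(e)=0$. - A ring topology $\tau$ on $K$ is henselian if $(K,\tau)$ is locally equivalent to a field $L$ with the topology induced by a nontrivial henselian valuation on $L$, i.e. both satisfy the same local sentences. Local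 sentences are those built from polynomial equations $t=0$ over $\mathbb Z$ and conditions $t\in U$ by Boolean connectives, quantifiers over elements, and quantifiers over neighbourhoods $U$ of $0$, where a variable $U$ bound by $\forall U$ occurs only positively and one bound by $\exists U$ only negatively in its scope. **Theorem.** Let $K/C$ be a separable field extension, $\tau$ a henselian topology on $K$, $c$ a well-ordered $p$-basis of $C$, and $X\subseteq K^m$ an existentially $\mathcal L_{\mathrm{ring}}(C)$-definable set, say $X=\{x\in K^m : K\models\exists y_1\cdots\exists y_n\,\varphi(x,y)\}$ with $\varphi$ a quantifier-free formula in the language of rings with parameters from $C$. Let $a\in X$. Then there is $b\in K^n$ with $K\models\varphi(a,b)$, and for every such $b$ there exists a neighbourhood $U$ of $\lambda_{K/b/c}a$ in $K^\ell$ (product topology of $\tau$) such that $$\sigma_{K/b/c}\bigl(\operatorname{locus}(\lambda_{K/b/c}a/C)(K)\cap U\bigr)\subseteq X.$$ -/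

import Mathlib

open Topology FirstOrder

universe u

/-! ### Separable extensions, `p`-independence and lambda functions

Throughout, `p` is the characteristic exponent of the fields involved. -/

/-- A (not necessarily algebraic) field extension `F / C` of characteristic exponent `p` is
separable if, inside an algebraic closure of `F`, it is linearly disjoint over `C` from
`C^(1/p)`, the field of the elements whose `p`-th power lies in `C`. -/
def IsSeparableExtension (p : ℕ) (C F : Type*) [Field C] [Field F] [Algebra C F] : Prop :=
  (IntermediateField.adjoin C {x : AlgebraicClosure F |
    x ^ p ∈ Set.range (algebraMap C (AlgebraicClosure F))}).LinearDisjoint F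

/-- The subfield `F^(p) D (A)` of `F` generated by the `p`-th powers, by `D` and by `A`. -/
def pSpan (p : ℕ) {F : Type*} [Field F] (D : Subfield F) (A : Set F) : Subfield F :=
  Subfield.closure ({y : F | ∃ x : F, x ^ p = y} ∪ (D : Set F) ∪ A)

/-- `A` is `p`-independent in `F` over `D`. -/
def IsPIndependent (p : ℕ) {F : Type*} [Field F] (D : Subfield F) (A : Set F) : Prop :=
  ∀ x ∈ A, x ∉ pSpan p D (A \ {x})

/-- `A` is a `p`-basis of `F` over `D`: it is `p`-independent and `p`-spanning.  The absolute
notion is the case where `D = ⊥` is the prime field. -/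
def IsPBasis (p : ℕ) {F : Type*} [Field F] (D : Subfield F) (A : Set F) : Prop :=
  IsPIndependent p D A ∧ pSpan p D A = ⊤

section Lambda

variable {K J : Type*} [Field K]

/-- `l` is a finitely supported family of elements of `K`, indexed by the finitely supported
multi-indices `I` with all entries `< p`, such that `x = ∑_I d^I * (l I)^p`. -/
def IsLambdaExpansion (p : ℕ) (d : J → K) (x : K) (l : (J →₀ ℕ) →₀ K) : Prop :=
  (∀ I ∈ l.support, ∀ j, I j < p) ∧
    x = l.sum fun I y => (I.prod fun j e => d j ^ e) * y ^ p

open Classical in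
/-- The lambda functions: for an (injectively indexed) `p`-independent family `d` in `K` and for
`x ∈ K^(p)(d)`, the value `lambdaCoeff p d x I` is `λ_I^d(x)`, the coefficient at `I` of the unique
expansion `x = ∑_I d^I * λ_I^d(x)^p`.  (Where there is no expansion it is `0`.) -/
noncomputable def lambdaCoeff (p : ℕ) (d : J → K) (x : K) : (J →₀ ℕ) →₀ K :=
  if h : ∃ l, IsLambdaExpansion p d x l then h.choose else 0

open Classical in
/-- A list of the elements of the (finite) set `{λ_I^d(x) | I}`: the nonzero values in the
lexicographic order of the multi-indices `I`, and then the element `0` if it is also a value. -/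
noncomputable def lambdaList [LinearOrder J] (p : ℕ) (d : J → K) (x : K) : List K :=
  (((lambdaCoeff p d x).support.map toLex.toEmbedding).sort).map
      (fun I => lambdaCoeff p d x (ofLex I)) ++
    if ∃ I : J →₀ ℕ, (∀ j, I j < p) ∧ lambdaCoeff p d x I = 0 then [0] else []

open Classical in
/-- The maximal subset of `B` that is `p`-independent in `K` over `D`, taken from the left: an
element is added if and only if it is `p`-independent over `D` together with what has already been
added (by the exchange property: it is not in the `p`-span of what has already been added). -/
noncomputable def pInd (p : ℕ) (D : Subfield K) (B : List K) : List K :=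
  B.foldl (fun acc x => if x ∈ pSpan p D {y | y ∈ acc} then acc else acc ++ [x]) []

variable {ι : Type*} [LinearOrder ι]

/-- The concatenation of the well-ordered family `c` (in the subfield `C`) with the list `A`. -/
def concatFamily {C : Subfield K} (c : ι → C) (A : List K) : ι ⊕ₗ Fin A.length → K :=
  fun j => Sum.elim (fun i => (c i : K)) A.get (ofLex j)

/-- The splitting pairs map `(A, B) ↦ (A', B')`, where `A'` is `A` followed by the leftmost maximal
subset of `B` that is `p`-independent in `K` over `C(A)`, and `B'` is `B` followed by
the values on `B` of the lambda functions with respect to the concatenation of `c` and `A'`.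
Ordered finite subsets of `K` are given by lists; a repeated entry counts only where it first
occurs. -/
noncomputable def splitPair (p : ℕ) {C : Subfield K} (c : ι → C) (P : List K × List K) :
    List K × List K :=
  let A' := P.1 ++ pInd p (Subfield.closure ((C : Set K) ∪ {y | y ∈ P.1})) P.2
  (A', P.2 ++ P.2.flatMap (lambdaList p (concatFamily c A')))

/-- The chain of pairs starting with `(∅, a)` and obtained by iterating the splitting pairs map. -/
noncomputable def lambdaChain (p : ℕ) {C : Subfield K} (c : ι → C) (a : List K) (n : ℕ) :
    List K × List K :=
  (splitPair p c)^[n] ([], a)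

/-- The set of the elements in the `n`-th pair of the chain. -/
def lambdaStage (p : ℕ) {C : Subfield K} (c : ι → C) (a : List K) (n : ℕ) : Set K :=
  {y | y ∈ (lambdaChain p c a n).1 ∨ y ∈ (lambdaChain p c a n).2}

/-- The tuple `b` is separable over the subfield `C(S)` of `K`, that is,
`C(S)(b) / C(S)` is separable. -/
def IsSeparableOver (p : ℕ) (C : Subfield K) (S : Set K) {n : ℕ} (b : Fin n → K) : Prop :=
  IsSeparableExtension p (IntermediateField.adjoin C S)
    (IntermediateField.adjoin (IntermediateField.adjoin C S) (Set.range b))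

/-- The underlying set of the tuple `λ_{K/b/c} a`: the elements of the `n`-th pair of the chain of
`a`, for the least `n` such that `b` is separable over the field that they generate over `C`. -/
noncomputable def lambdaSet (p : ℕ) {C : Subfield K} (c : ι → C) {m n : ℕ}
    (b : Fin n → K) (a : Fin m → K) : Set K :=
  lambdaStage p c (List.ofFn a)
    (sInf {k : ℕ | IsSeparableOver p C (lambdaStage p c (List.ofFn a) k) b})

theorem subset_lambdaChain (p : ℕ) {C : Subfield K} (c : ι → C) (a : List K) (n : ℕ) :
    a ⊆ (lambdaChain p c a n).2 := by
  induction n with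
  | zero => exact fun _ h => h
  | succ n ih =>
    rw [lambdaChain, Function.iterate_succ_apply']
    exact fun x hx => List.mem_append_left _ (ih hx)

theorem mem_lambdaSet (p : ℕ) {C : Subfield K} (c : ι → C) {m n : ℕ}
    (b : Fin n → K) (a : Fin m → K) (i : Fin m) : a i ∈ lambdaSet p c b a :=
  Or.inr (subset_lambdaChain p c _ _ (by simp [List.mem_ofFn]))

/-- The tuple `λ_{K/b/c} a`, as a point of the affine space with one coordinate for each of its
elements. -/
def lambdaTuple (p : ℕ) {C : Subfield K} (c : ι → C) {m n : ℕ}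
    (b : Fin n → K) (a : Fin m → K) : lambdaSet p c b a → K :=
  Subtype.val

/-- The coordinate projection `σ_{K/b/c}`, which maps `λ_{K/b/c} a` to `a`. -/
def lambdaProj (p : ℕ) {C : Subfield K} (c : ι → C) {m n : ℕ}
    (b : Fin n → K) (a : Fin m → K) (y : lambdaSet p c b a → K) : Fin m → K :=
  fun i => y ⟨a i, mem_lambdaSet p c b a i⟩

/-- The `K`-rational points of the locus of a tuple `a` over `C`: the zero set in affine space of
all the polynomials over `C` that vanish at `a`. -/
def locus {σ : Type*} (C : Subfield K) (a : σ → K) : Set (σ → K) :=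
  {y | ∀ f : MvPolynomial σ C, MvPolynomial.aeval a f = 0 → MvPolynomial.aeval y f = 0}

end Lambda

/-! ### Existential formulas -/

section Existential

variable {K : Type*} [Field K]

/-- The formulas `φ(x₁, …, x_m; y₁, …, y_n)` in the language of rings with parameters from `C`. -/
abbrev RingFormulaOver (C : Subfield K) (m n : ℕ) : Type _ :=
  (Language.ring[[((C : Set K) : Type _)]]).BoundedFormula (Fin m) n

/-- `φ(a; b)` holds in the field `K`. -/
def HoldsAt {C : Subfield K} {m n : ℕ} (φ : RingFormulaOver C m n)
    (a : Fin m → K) (b : Fin n → K) : Prop :=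
  letI := FirstOrder.Ring.compatibleRingOfRing K
  φ.Realize a b

/-- The set defined in `K` by the formula `∃ y₁ … y_n, φ(x₁, …, x_m; y₁, …, y_n)`. -/
def existsSet {C : Subfield K} {m n : ℕ} (φ : RingFormulaOver C m n) : Set (Fin m → K) :=
  letI := FirstOrder.Ring.compatibleRingOfRing K
  {a | φ.exs.Realize a}

/-- `X ⊆ K^m` is defined by the existential formula `∃ y₁ … y_n, φ`, with `φ` quantifier-free. -/
def IsExistentiallyDefinedBy {C : Subfield K} {m n : ℕ} (X : Set (Fin m → K))
    (φ : RingFormulaOver C m n) : Prop :=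
  φ.IsQF ∧ X = existsSet φ

end Existential

/-! ### Henselian topologies -/

/-- Local formulas about a ring with a filter of neighbourhoods of `0`, in negation normal form,
with `n` free element variables.  A set variable ranges over neighbourhoods of `0`; a universally
quantified one may occur only positively (there are `k` such free variables), an existentially
quantified one only negatively (there are `l` such free variables). -/
inductive LocalFormula : ℕ → ℕ → ℕ → Type
  | eq {n k l : ℕ} (t : MvPolynomial (Fin n) ℤ) : LocalFormula n k l
  | ne {n k l : ℕ} (t : MvPolynomial (Fin n) ℤ) : LocalFormula n k l
  | mem {n k l : ℕ} (t : MvPolynomial (Fin n) ℤ) (U : Fin k) : LocalFormula n k l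
  | notMem {n k l : ℕ} (t : MvPolynomial (Fin n) ℤ) (U : Fin l) : LocalFormula n k l
  | and {n k l : ℕ} (φ ψ : LocalFormula n k l) : LocalFormula n k l
  | or {n k l : ℕ} (φ ψ : LocalFormula n k l) : LocalFormula n k l
  | all {n k l : ℕ} (φ : LocalFormula (n + 1) k l) : LocalFormula n k l
  | ex {n k l : ℕ} (φ : LocalFormula (n + 1) k l) : LocalFormula n k l
  | allNhd {n k l : ℕ} (φ : LocalFormula n (k + 1) l) : LocalFormula n k l
  | exNhd {n k l : ℕ} (φ : LocalFormula n k (l + 1)) : LocalFormula n k l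

/-- Truth of a local formula in the ring `R` with the topology `τ`. -/
def LocalFormula.Realize (R : Type*) [CommRing R] (τ : TopologicalSpace R) :
    {n k l : ℕ} → LocalFormula n k l → (Fin n → R) → (Fin k → Set R) → (Fin l → Set R) → Prop
  | _, _, _, .eq t, v, _, _ => MvPolynomial.aeval v t = 0
  | _, _, _, .ne t, v, _, _ => MvPolynomial.aeval v t ≠ 0
  | _, _, _, .mem t U, v, P, _ => MvPolynomial.aeval v t ∈ P U
  | _, _, _, .notMem t U, v, _, N => MvPolynomial.aeval v t ∉ N U
  | _, _, _, .and φ ψ, v, P, N => φ.Realize R τ v P N ∧ ψ.Realize R τ v P N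
  | _, _, _, .or φ ψ, v, P, N => φ.Realize R τ v P N ∨ ψ.Realize R τ v P N
  | _, _, _, .all φ, v, P, N => ∀ x : R, φ.Realize R τ (Fin.snoc v x) P N
  | _, _, _, .ex φ, v, P, N => ∃ x : R, φ.Realize R τ (Fin.snoc v x) P N
  | _, _, _, .allNhd φ, v, P, N => ∀ U ∈ 𝓝 (0 : R), φ.Realize R τ v (Fin.snoc P U) N
  | _, _, _, .exNhd φ, v, P, N => ∃ U ∈ 𝓝 (0 : R), φ.Realize R τ v P (Fin.snoc N U)

/-- Two topological rings are locally equivalent if they satisfy the same local sentences. -/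
def LocallyEquivalent (R S : Type*) [CommRing R] [CommRing S]
    (τ : TopologicalSpace R) (τ' : TopologicalSpace S) : Prop :=
  ∀ φ : LocalFormula 0 0 0,
    φ.Realize R τ Fin.elim0 Fin.elim0 Fin.elim0 ↔ φ.Realize S τ' Fin.elim0 Fin.elim0 Fin.elim0

/-- The topology on a field `L` induced by (the valuation of) a valuation subring. -/
noncomputable abbrev valuationSubringTopology {L : Type*} [Field L] (A : ValuationSubring L) :
    TopologicalSpace L :=
  (Valued.mk' A.valuation).toTopologicalSpace

/-- A ring topology on a field `K` is henselian if it is locally equivalent to the topology induced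
by a nontrivial henselian valuation on some field `L`. -/
def IsHenselianTopology (K : Type u) [Field K] (τ : TopologicalSpace K) : Prop :=
  IsTopologicalRing K ∧ ∃ (L : Type u) (_ : Field L) (A : ValuationSubring L),
    A ≠ ⊤ ∧ HenselianLocalRing A ∧ LocallyEquivalent K L τ (valuationSubringTopology A)

/-!
The point of the theorem is that a tuple `b` which is separable over `C(e)` can be moved along
with `e`, where `e = λ_{K/b/c} a`. Indeed, `C(e)(b)` then has a separating transcendence basis `t`
over `C(e)`. Elements of `t` satisfy no relations with `e`, so they may be kept fixed when `e`
moves inside its locus (`sumElim_mem_locus`). The rest of `b` is separable algebraic over `C(e,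
t)`, hence generated by a primitive element, a simple root of a polynomial with coefficients
depending continuously on `e`; such a root persists in a henselian topology
(`IsHenselianTopology.eventually_exists_root`), and the corresponding specialization respects all
polynomial relations over `C` (`IsHenselianTopology.eventually_exists_mem_locus`). Nonvanishing of
polynomials is respected as well, because the inverses of their values can be added to `b`.

A henselian topology is only given by the local sentences that it satisfies. Two kinds of
sentences are used: one says that points are separated from `0`, the others say that polynomials
`1 + Y + ∑ ε_i Y^(i+1)` with small `ε_i` have roots. The latter hold for henselian valuations by
Hensel's lemma for the reversed polynomial, and they imply the persistence of simple roots in any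
ring topology by a substitution.

It remains to see that the chain of splitting pairs reaches a field over which `b` is separable,
so that the infimum in the definition of `lambdaSet` is attained
(`exists_isSeparableOver_lambdaStage`). Let `F` be the field generated by the union of the chain,
and `d` the concatenation of `c` with the union of the first components. The family `d` is
`p`-independent in `K`, so that its reduced monomials are linearly independent over `K^(p)`; and
`F = F^(p)(d)`, since the chain is closed under lambda functions. A relation `∑ fᵢ xᵢ^p = 0` with
`fᵢ ∈ F` therefore splits into relations between the `xᵢ` over `F`, which is MacLane's criterion
for the separability of `K / F` (`preservesIndepPow_adjoin_iUnion_lambdaStage`). So `F(b) / F` is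
separably generated, which is witnessed by finitely many elements of `F` and thus already holds at
a finite stage of the chain.
-/

/-! ### Separability and linear independence of `p`-th powers -/

/-- Raising to the `p`-th power preserves `F`-linear independence in the `F`-algebra `A`.  For a
field extension of characteristic exponent `p` this is MacLane's criterion for separability. -/
def PreservesIndepPow (p : ℕ) (F A : Type*) [Field F] [CommRing A] [Algebra F A] : Prop :=
  ∀ (n : ℕ) (x : Fin n → A), LinearIndependent F x → LinearIndependent F fun i => x i ^ p

section PowIndep

variable {p : ℕ} {F A : Type*} [Field F] [CommRing A] [Algebra F A]

theorem PreservesIndepPow.linearIndependent (h : PreservesIndepPow p F A) {ι : Type*} {x : ι → A}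
    (hx : LinearIndependent F x) : LinearIndependent F fun i => x i ^ p := by
  rw [linearIndependent_iff_finset_linearIndependent] at hx ⊢
  intro s
  have h1 := h _ _ ((hx s).comp _ s.equivFin.symm.injective)
  have h2 := h1.comp _ s.equivFin.injective
  convert h2 using 1
  funext i
  simp

theorem PreservesIndepPow.of_injective {B : Type*} [CommRing B] [Algebra F B]
    (h : PreservesIndepPow p F B) (f : A →ₐ[F] B) (hf : Function.Injective f) :
    PreservesIndepPow p F A := by
  intro n x hx
  have h1 := h _ _ (hx.map' f.toLinearMap (LinearMap.ker_eq_bot_of_injective hf))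
  refine LinearIndependent.of_comp f.toLinearMap ?_
  convert h1 using 2 with i
  simp

open Module in
/-- A Frobenius-semilinear map is determined on `a` by the coordinates of `a` in a basis. -/
theorem linearCombination_mapRange_frobenius [ExpChar F p] {κ M : Type*} [AddCommGroup M]
    [Module F M] (e : Basis κ F A) (Q : A →+ M) (hQ : ∀ (c : F) (a : A), Q (c • a) = c ^ p • Q a)
    (a : A) :
    Finsupp.linearCombination F (fun k => Q (e k))
      ((e.repr a).mapRange (frobenius F p) (map_zero _)) = Q a := by
  conv_rhs => rw [← e.linearCombination_repr a]
  generalize e.repr a = l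
  induction l using Finsupp.induction_linear with
  | zero => simp
  | add f g hf hg =>
    rw [Finsupp.mapRange_add (map_add _), map_add, hf, hg, map_add, map_add]
  | single k c =>
    rw [Finsupp.mapRange_single, Finsupp.linearCombination_single,
      Finsupp.linearCombination_single, hQ]
    rfl

open Module in
/-- The additive map that raises the coordinates in the basis `e` to the `p`-th power. -/
theorem exists_frobenius_repr [ExpChar F p] {κ : Type*} (e : Basis κ F A) :
    ∃ Q : A →+ (κ →₀ F), (∀ (c : F) (a : A), Q (c • a) = c ^ p • Q a) ∧
      ∀ a, Q a = (e.repr a).mapRange (frobenius F p) (map_zero _) := by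
  refine ⟨(Finsupp.mapRange.addMonoidHom (frobenius F p).toAddMonoidHom).comp
    (e.repr : A ≃ₗ[F] _).toLinearMap.toAddMonoidHom, ?_, ?_⟩
  · intro c a
    ext k
    simp [frobenius_def, mul_pow]
  · intro a
    ext k
    simp

open Module in
/-- It suffices to test MacLane's criterion on one basis: the matrices of base change and their
Frobenius twists are inverse to each other. -/
theorem PreservesIndepPow.of_basis [ExpChar F p] [ExpChar A p] {κ : Type*} (e : Basis κ F A)
    (he : LinearIndependent F fun k => e k ^ p) : PreservesIndepPow p F A := by
  intro n x hx
  let b := Basis.extend hx.linearIndepOn_id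
  suffices hb : LinearIndependent F fun i => b i ^ p by
    let f (i : Fin n) : (hx.linearIndepOn_id.extend (Set.range x).subset_univ) :=
      ⟨x i, hx.linearIndepOn_id.subset_extend _ ⟨i, rfl⟩⟩
    have := hb.comp f fun _ _ heq ↦ hx.injective (by simpa only [f, Subtype.mk.injEq] using heq)
    convert this using 2 with i
    simp only [Function.comp_apply, b]
    rw [Basis.extend_apply_self]
  obtain ⟨Qe, hQe, hQe'⟩ := exists_frobenius_repr (p := p) e
  obtain ⟨Qb, hQb, hQb'⟩ := exists_frobenius_repr (p := p) b
  have hQF : ∀ (c : F) (a : A),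
      (frobenius A p).toAddMonoidHom (c • a) = c ^ p • (frobenius A p).toAddMonoidHom a := by
    intro c a
    simp [frobenius_def, Algebra.smul_def, mul_pow]
  let T := Finsupp.linearCombination F (fun i => Qe (b i))
  let T' := Finsupp.linearCombination F (fun k => Qb (e k))
  have hT : T' ∘ₗ T = LinearMap.id := by
    ext1 i
    ext1
    simp only [T, T', LinearMap.comp_apply, Finsupp.lsingle_apply,
      Finsupp.linearCombination_single, one_smul, LinearMap.id_apply]
    rw [hQe', linearCombination_mapRange_frobenius e Qb hQb, hQb', Basis.repr_self,
      Finsupp.mapRange_single, map_one]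
  have hcomp : Finsupp.linearCombination F (fun i => b i ^ p) =
      Finsupp.linearCombination F (fun k => e k ^ p) ∘ₗ T := by
    ext1 i
    ext1
    simp only [T, LinearMap.comp_apply, Finsupp.lsingle_apply,
      Finsupp.linearCombination_single, one_smul]
    rw [hQe']
    exact (linearCombination_mapRange_frobenius e _ hQF (b i)).symm
  rw [LinearIndependent, hcomp, LinearMap.coe_comp]
  refine Function.Injective.comp he (Function.LeftInverse.injective (g := T') fun l => ?_)
  exact congrArg (fun f => f l) hT

theorem PreservesIndepPow.mvPolynomial [ExpChar F p] (σ : Type*) :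
    PreservesIndepPow p F (MvPolynomial σ F) := by
  refine .of_basis (MvPolynomial.basisMonomials σ F) ?_
  have hp : p ≠ 0 := (expChar_pos F p).ne'
  have := (MvPolynomial.basisMonomials σ F).linearIndependent.comp (fun s => p • s)
    fun s t h => Finsupp.ext fun i => by
      have := DFunLike.congr_fun h i
      simpa [hp] using this
  convert! this using 2 with s
  simp [MvPolynomial.monomial_pow]

theorem PreservesIndepPow.of_isFractionRing [IsDomain A] {L : Type*} [Field L] [Algebra F L]
    [Algebra A L] [IsScalarTower F A L] [IsFractionRing A L] (h : PreservesIndepPow p F A) :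
    PreservesIndepPow p F L := by
  intro n x hx
  obtain ⟨q, hq⟩ := IsLocalization.exist_integer_multiples_of_finite (nonZeroDivisors A) x
  choose y hy using hq
  have hq0 : algebraMap A L q ≠ 0 := by simp
  have hinj : Function.Injective (algebraMap A L) := IsFractionRing.injective A L
  have hy1 : ∀ i, algebraMap A L (y i) = algebraMap A L q * x i := fun i => by
    rw [hy, Algebra.smul_def]
  have aux : ∀ (z : L), z ≠ 0 → ∀ w : Fin n → L, LinearIndependent F (fun i => z * w i) ↔
      LinearIndependent F w := by
    intro z hz w
    have := LinearMap.linearIndependent_iff (LinearMap.mulLeft F z) (v := w)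
      (LinearMap.ker_eq_bot_of_injective fun a b hab => mul_left_cancel₀ hz hab)
    exact this
  have h1 : LinearIndependent F y := by
    refine LinearIndependent.of_comp (IsScalarTower.toAlgHom F A L).toLinearMap ?_
    have := (aux _ hq0 x).2 hx
    convert! this using 2 with i
    simpa using hy1 i
  have h2 := (h _ _ h1).map' (IsScalarTower.toAlgHom F A L).toLinearMap
    (LinearMap.ker_eq_bot_of_injective hinj)
  rw [← aux _ (pow_ne_zero p hq0)]
  convert! h2 using 2 with i
  simp [hy1, mul_pow]

open Module in
theorem PreservesIndepPow.trans [ExpChar F p] {L E : Type*} [Field L] [Field E] [Algebra F L]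
    [Algebra F E] [Algebra L E] [IsScalarTower F L E] (h : PreservesIndepPow p F L)
    (h' : PreservesIndepPow p L E) : PreservesIndepPow p F E := by
  have : ExpChar E p := expChar_of_injective_algebraMap (algebraMap F E).injective p
  let b := Basis.ofVectorSpace F L
  let c := Basis.ofVectorSpace L E
  refine .of_basis (b.smulTower c) ?_
  have := linearIndependent_smul (h.linearIndependent b.linearIndependent)
    (h'.linearIndependent c.linearIndependent)
  convert this using 2 with i
  simp [Basis.smulTower_apply, Algebra.smul_def, mul_pow]

/-- A separably generated extension satisfies MacLane's criterion. -/
theorem PreservesIndepPow.of_separating {K σ ι : Type*} [ExpChar F p] [Field K] [Algebra F K]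
    {t : σ → K} (ht : AlgebraicIndependent F t) {b : ι → K}
    (hb : ∀ j, IsSeparable (IntermediateField.adjoin F (Set.range t)) (b j)) :
    PreservesIndepPow p F (IntermediateField.adjoin F (Set.range b)) := by
  set L := IntermediateField.adjoin F (Set.range t)
  open scoped IntermediateField.algebraAdjoinAdjoin in
  have h1 : PreservesIndepPow p F L :=
    .of_isFractionRing (A := Algebra.adjoin F (Set.range t))
      ((PreservesIndepPow.mvPolynomial σ).of_injective ht.aevalEquiv.symm.toAlgHom
        ht.aevalEquiv.symm.injective)
  have : ExpChar L p := expChar_of_injective_algebraMap (algebraMap F _).injective p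
  let M := IntermediateField.adjoin L (Set.range b)
  have : Algebra.IsSeparable L M := (IntermediateField.isSeparable_adjoin_iff_isSeparable L K).2 (by
    rintro _ ⟨j, rfl⟩
    exact hb j)
  have h2 : PreservesIndepPow p L M := fun n x hx => by
    simpa using hx.map_pow_expChar_pow_of_isSeparable p 1
  have hle : IntermediateField.adjoin F (Set.range b) ≤ M.restrictScalars F :=
    IntermediateField.adjoin_le_iff.2 (IntermediateField.subset_adjoin L (Set.range b))
  have h3 : PreservesIndepPow p F M := h1.trans h2
  exact PreservesIndepPow.of_injective (B := M) h3
    (IntermediateField.inclusion hle) (IntermediateField.inclusion_injective hle)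

/-- Separability of `x` over `L`, expressed by a polynomial over the big field, so that it can be
compared for different subfields. -/
theorem isSeparable_iff_exists_polynomial {L K : Type*} [Field L] [Field K] [Algebra L K] {x : K} :
    IsSeparable L x ↔ ∃ f : Polynomial K, f.Separable ∧ f.eval x = 0 ∧
      ∀ i, f.coeff i ∈ Set.range (algebraMap L K) := by
  constructor
  · intro h
    refine ⟨(minpoly L x).map (algebraMap L K), Polynomial.Separable.map h, ?_, fun i => ?_⟩
    · rw [Polynomial.eval_map_algebraMap, minpoly.aeval]
    · rw [Polynomial.coeff_map]
      exact ⟨_, rfl⟩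
  · rintro ⟨f, hf, hx, hi⟩
    obtain ⟨g, rfl⟩ := (Polynomial.mem_lifts f).1 ((Polynomial.lifts_iff_coeff_lifts f).2 hi)
    rw [Polynomial.eval_map_algebraMap] at hx
    exact Polynomial.Separable.of_dvd ((Polynomial.separable_map _).1 hf) (minpoly.dvd L x hx)

/-- MacLane's theorem, in all characteristic exponents: a finitely generated extension that
satisfies the criterion has a separating transcendence basis. -/
theorem PreservesIndepPow.exists_finset {E : Type*} [ExpChar F p] [Field E] [Algebra F E]
    [Algebra.EssFiniteType F E] (h : PreservesIndepPow p F E) :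
    ∃ s : Finset E, AlgebraicIndependent F ((↑) : s → E) ∧
      ∀ x : E, IsSeparable (IntermediateField.adjoin F (s : Set E)) x := by
  rcases ‹ExpChar F p› with _ | hp
  · obtain ⟨s, h1, h2⟩ := exists_isTranscendenceBasis_and_isSeparable_of_perfectField F E
    exact ⟨s, h1.1, fun x => Algebra.IsSeparable.isSeparable _ x⟩
  · have : ExpChar F p := .prime hp
    obtain ⟨s, h1, h2⟩ :=
      exists_isTranscendenceBasis_and_isSeparable_of_linearIndepOn_pow_of_essFiniteType p hp
        (K := E) fun s hs => h.linearIndependent hs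
    exact ⟨s, h1.1, fun x => Algebra.IsSeparable.isSeparable _ x⟩

theorem IsSeparable.val_of_intermediateField {K : Type*} [Field K] [Algebra F K]
    {E : IntermediateField F K} {s : Set E} {x : E}
    (h : IsSeparable (IntermediateField.adjoin F s) x) :
    IsSeparable (IntermediateField.adjoin F (E.val '' s)) (x : K) := by
  obtain ⟨f, hf, hf0, hfc⟩ := isSeparable_iff_exists_polynomial.1 h
  refine isSeparable_iff_exists_polynomial.2 ⟨f.map (algebraMap E K), hf.map, ?_, fun i => ?_⟩
  · have h1 := Polynomial.eval_map_apply (p := f) (f := algebraMap E K) x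
    rw [hf0, map_zero] at h1
    exact h1
  · obtain ⟨y, hy⟩ := hfc i
    rw [Polynomial.coeff_map, ← hy, ← IntermediateField.adjoin_map]
    exact ⟨⟨_, ⟨y, y.2, rfl⟩⟩, rfl⟩

/-- The existence of separating transcendence bases, for subfields of a given field. -/
theorem PreservesIndepPow.exists_separating {K : Type*} [ExpChar F p] [Field K] [Algebra F K]
    {E : IntermediateField F K} [Algebra.EssFiniteType F E] (h : PreservesIndepPow p F E) :
    ∃ (r : ℕ) (t : Fin r → K), AlgebraicIndependent F t ∧
      ∀ x ∈ E, IsSeparable (IntermediateField.adjoin F (Set.range t)) x := by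
  obtain ⟨s, hs1, hs2⟩ := h.exists_finset
  have ht := (hs1.comp _ s.equivFin.symm.injective).map' (f := E.val) E.val.injective
  refine ⟨s.card, _, ht, fun x hx => ?_⟩
  have h1 := (hs2 ⟨x, hx⟩).val_of_intermediateField
  have hr : Set.range (E.val ∘ (fun i : s => (i : E)) ∘ s.equivFin.symm) =
      E.val '' (s : Set E) := by
    rw [Set.range_comp, Set.range_comp, Equiv.range_eq_univ, Set.image_univ]
    exact congrArg _ Subtype.range_coe
  exact hr ▸ h1

theorem sum_mul_pow_of_pow_eq {C F E : Type*} [Field C] [Field F] [Field E] [Algebra C F]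
    [Algebra F E] [Algebra C E] [IsScalarTower C F E] [ExpChar E p] {ι : Type*} (s : Finset ι)
    (g : ι → C) (r : ι → E) (x : ι → F) (h : ∀ i ∈ s, r i ^ p = algebraMap C E (g i)) :
    (∑ i ∈ s, r i * algebraMap F E (x i)) ^ p = algebraMap F E (∑ i ∈ s, g i • x i ^ p) := by
  rw [← frobenius_def, map_sum, map_sum]
  refine Finset.sum_congr rfl fun i hi => ?_
  rw [frobenius_def, mul_pow, h i hi, Algebra.smul_def, map_mul, map_pow,
    ← IsScalarTower.algebraMap_apply]

/-- MacLane's criterion. -/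
theorem isSeparableExtension_iff {C F : Type*} [Field C] [Field F] [Algebra C F] [ExpChar C p] :
    IsSeparableExtension p C F ↔ PreservesIndepPow p C F := by
  have hp : p ≠ 0 := (expChar_pos C p).ne'
  have : ExpChar (AlgebraicClosure F) p :=
    expChar_of_injective_algebraMap (algebraMap C (AlgebraicClosure F)).injective p
  constructor
  -- A relation `∑ gᵢ xᵢ^p = 0` is the `p`-th power of a relation with coefficients `gᵢ^(1/p)`.
  · intro H n x hx
    have h1 := H.linearIndependent_right' hx
    rw [linearIndependent_iff'] at h1 ⊢
    intro s g hg i hi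
    have hr : ∀ i, ∃ r : AlgebraicClosure F, r ^ p = algebraMap C _ (g i) := fun i =>
      IsAlgClosed.exists_pow_nat_eq _ (Nat.pos_of_ne_zero hp)
    choose r hr using hr
    have h2 := h1 s (fun i => ⟨r i, IntermediateField.subset_adjoin C _ ⟨g i, (hr i).symm⟩⟩) (by
      have := sum_mul_pow_of_pow_eq s g r x fun i _ => hr i
      rw [hg, map_zero] at this
      simpa [Algebra.smul_def, IntermediateField.algebraMap_apply] using
        eq_zero_of_pow_eq_zero this) i hi
    have h3 : r i = 0 := congrArg Subtype.val h2
    have h4 := hr i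
    rw [h3, zero_pow hp] at h4
    simpa using h4.symm
  · intro H
    refine IntermediateField.LinearDisjoint.of_basis_right' (Module.Basis.ofVectorSpace C F) ?_
    have h0 := H.linearIndependent (Module.Basis.ofVectorSpace C F).linearIndependent
    have hmem : ∀ y ∈ IntermediateField.adjoin C {x : AlgebraicClosure F |
        x ^ p ∈ Set.range (algebraMap C (AlgebraicClosure F))},
        y ^ p ∈ (algebraMap C (AlgebraicClosure F)).fieldRange := by
      intro y hy
      induction hy using IntermediateField.adjoin_induction with
      | mem x hx => exact hx
      | algebraMap x => exact ⟨x ^ p, map_pow _ _ _⟩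
      | add x y _ _ hx hy =>
        rw [← frobenius_def, map_add]
        exact add_mem hx hy
      | inv x _ hx =>
        rw [inv_pow]
        exact inv_mem hx
      | mul x y _ _ hx hy =>
        rw [mul_pow]
        exact mul_mem hx hy
    rw [linearIndependent_iff'] at h0 ⊢
    intro s g hg i hi
    have hr : ∀ i, ∃ c : C, algebraMap C (AlgebraicClosure F) c = (g i : AlgebraicClosure F) ^ p :=
      fun i => hmem _ (g i).2
    choose c hc using hr
    have h1 := h0 s c (by
      apply (algebraMap F (AlgebraicClosure F)).injective
      rw [← sum_mul_pow_of_pow_eq s c (fun i => (g i : AlgebraicClosure F)) _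
        fun i _ => (hc i).symm, map_zero]
      refine (pow_eq_zero_iff hp).2 ?_
      simpa [Algebra.smul_def, IntermediateField.algebraMap_apply] using hg) i hi
    have h2 := hc i
    rw [h1, map_zero] at h2
    exact Subtype.ext (eq_zero_of_pow_eq_zero h2.symm)

end PowIndep

/-! ### Monomials in `p`-independent elements -/

section PFree

variable {p : ℕ} {K : Type*} [Field K]

/-- The monomials `d^I`, with all exponents `< p`, of the finite family `d` are linearly independent
over the field of `p`-th powers of `K`. -/
def IsPFree (p : ℕ) {J : Type*} [Fintype J] [DecidableEq J] (d : J → K) : Prop :=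
  ∀ y : (J → Fin p) → K, ∑ I, (∏ j, d j ^ (I j : ℕ)) * y I ^ p = 0 → y = 0

/-- If `x ^ p ∈ E` but `x ∉ E`, then `1, x, …, x ^ (p - 1)` are linearly independent over `E`. -/
theorem linearIndependent_pow_of_notMem {E : Type*} [Field E] [Algebra E K] [ExpChar K p]
    (hp : p.Prime) {x : K} {a : E} (ha : algebraMap E K a = x ^ p)
    (hx : x ∉ Set.range (algebraMap E K)) : LinearIndependent E fun i : Fin p => x ^ (i : ℕ) := by
  have hirr : Irreducible (Polynomial.X ^ p - Polynomial.C a) := by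
    refine X_pow_sub_C_irreducible_of_prime hp fun b hb => hx ⟨b, ?_⟩
    refine frobenius_inj K p ?_
    simp only [frobenius_def]
    rw [← ha, ← hb, map_pow]
  have hmin : Polynomial.X ^ p - Polynomial.C a = minpoly E x :=
    minpoly.eq_of_irreducible_of_monic hirr (by simp [ha])
      (Polynomial.monic_X_pow_sub_C _ hp.ne_zero)
  have hdeg : (minpoly E x).natDegree = p := by
    rw [← hmin, Polynomial.natDegree_X_pow_sub_C]
  exact (linearIndependent_pow (K := E) x).comp (Fin.cast hdeg.symm) (Fin.cast_injective _)

/-- If no `d i` lies in the field generated over `E ⊇ K^(p)` by its predecessors, then the monomials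
in `d` with exponents `< p` are linearly independent over `E`. -/
theorem linearIndependent_monomials {E : Type*} [Field E] [Algebra E K] [ExpChar K p]
    (hp : p.Prime) (hE : ∀ x : K, ∃ y : E, algebraMap E K y = x ^ p) {n : ℕ} (d : Fin n → K)
    (hd : ∀ i, d i ∉ IntermediateField.adjoin E (d '' {j | j < i})) :
    LinearIndependent E fun I : Fin n → Fin p => ∏ j, d j ^ (I j : ℕ) := by
  induction n with
  | zero =>
    refine LinearIndependent.of_subsingleton (default : Fin 0 → Fin p) ?_
    simp
  | succ n ih =>
    let E' := IntermediateField.adjoin E (Set.range (d ∘ Fin.castSucc))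
    have ih' := ih (d ∘ Fin.castSucc) fun i hi => hd i.castSucc <|
      IntermediateField.adjoin.mono _ _ _ (by
        rintro _ ⟨j, hj, rfl⟩
        exact ⟨j.castSucc, by simpa using hj, rfl⟩) hi
    have hlast : d (Fin.last n) ∉ Set.range (algebraMap E' K) := by
      rintro ⟨y, hy⟩
      refine hd (Fin.last n) (hy ▸ IntermediateField.adjoin.mono _ _ _ ?_ y.2)
      rintro _ ⟨j, rfl⟩
      exact ⟨j.castSucc, Fin.castSucc_lt_last j, rfl⟩
    obtain ⟨a, ha⟩ := hE (d (Fin.last n))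
    have hc := linearIndependent_pow_of_notMem (E := E') hp (a := algebraMap E E' a) (by
      rw [← IsScalarTower.algebraMap_apply, ha]) hlast
    let b : (Fin n → Fin p) → E' := fun I =>
      ⟨∏ j, (d ∘ Fin.castSucc) j ^ (I j : ℕ), prod_mem fun j _ => pow_mem
        (IntermediateField.subset_adjoin _ _ (Set.mem_range_self j)) _⟩
    have hb : LinearIndependent E b := ih'.of_comp E'.val.toLinearMap
    have h := (linearIndependent_smul hb hc).comp
      (fun I : Fin (n + 1) → Fin p => (I ∘ Fin.castSucc, I (Fin.last n))) (by
        intro I I' h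
        simp only [Prod.mk.injEq] at h
        funext j
        induction j using Fin.lastCases with
        | last => exact h.2
        | cast i => exact congrFun h.1 i)
    convert! h using 2 with I
    rw [Fin.prod_univ_castSucc]
    rfl

variable {J J' : Type*} [Fintype J] [DecidableEq J] [Fintype J'] [DecidableEq J']

theorem IsPFree.reindex (e : J ≃ J') {d : J' → K} (h : IsPFree p (d ∘ e)) : IsPFree p d := by
  intro y hy
  have h1 := h (fun I => y (I ∘ e.symm)) (by
    rw [← hy, ← Equiv.sum_comp (Equiv.arrowCongr e (Equiv.refl (Fin p)))]
    refine Finset.sum_congr rfl fun I _ => ?_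
    congr 1
    rw [← Equiv.prod_comp e]
    simp)
  funext I
  simpa [Function.comp_assoc] using congrFun h1 (I ∘ e)

theorem IsPFree.of_linearIndependent {E : Subfield K} (hE : ∀ x : K, x ^ p ∈ E)
    {d : J → K} (h : LinearIndependent E fun I : J → Fin p => ∏ j, d j ^ (I j : ℕ)) :
    IsPFree p d := by
  intro y hy
  have := Fintype.linearIndependent_iff.1 h (fun I => ⟨y I ^ p, hE _⟩) (by
    rw [← hy]
    exact Finset.sum_congr rfl fun I _ => mul_comm _ _)
  funext I
  exact eq_zero_of_pow_eq_zero (congrArg Subtype.val (this I))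

theorem IsPIndependent.isPFree [ExpChar K p] (hp : p.Prime) {D : Subfield K} {A : Set K}
    (hA : IsPIndependent p D A) {d : J → K} (hd : Function.Injective d) (hdA : ∀ j, d j ∈ A) :
    IsPFree p d := by
  refine .reindex (Fintype.equivFin J).symm ?_
  have hE : ∀ x : K, x ^ p ∈ (frobenius K p).fieldRange := fun x => ⟨x, rfl⟩
  refine .of_linearIndependent hE (linearIndependent_monomials hp
    (fun x => ⟨⟨x ^ p, hE x⟩, rfl⟩) _ fun i hi => hA _ (hdA ((Fintype.equivFin J).symm i)) ?_)
  refine (Subfield.closure_le (t := pSpan p D _)).2 ?_ hi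
  rintro _ (⟨⟨_, x, rfl⟩, rfl⟩ | ⟨j, hj, rfl⟩)
  · exact Subfield.subset_closure (.inl (.inl ⟨x, rfl⟩))
  · refine Subfield.subset_closure (.inr ⟨hdA _, fun h => (ne_of_lt (Set.mem_ofPred.1 hj)) ?_⟩)
    simpa using hd h

/-- In a separable extension, `p`-independent families remain `p`-independent. -/
theorem IsPFree.map {C : Type*} [Field C] [Algebra C K] [ExpChar C p] [ExpChar K p]
    (hCK : PreservesIndepPow p C K) {d : J → C} (h : IsPFree p d) :
    IsPFree p fun j => algebraMap C K (d j) := by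
  classical
  intro y hy
  let e := Module.Basis.ofVectorSpace C K
  let s := Finset.univ.biUnion fun I => (e.repr (y I)).support
  have hs : ∀ I, y I ^ p = ∑ k ∈ s, (e.repr (y I) k) ^ p • e k ^ p := by
    intro I
    conv_lhs => rw [← e.linearCombination_repr (y I), Finsupp.linearCombination_apply,
      Finsupp.sum_of_support_subset _ (s := s) (Finset.subset_biUnion_of_mem
        (fun I => (e.repr (y I)).support) (Finset.mem_univ I)) _ (by simp),
      ← frobenius_def, map_sum]
    simp [frobenius_def, Algebra.smul_def, mul_pow]
  have h1 := linearIndependent_iff'.1 (hCK.linearIndependent e.linearIndependent) s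
    (fun k => ∑ I, (∏ j, d j ^ (I j : ℕ)) * (e.repr (y I) k) ^ p) (by
      rw [← hy]
      simp_rw [hs, Finset.sum_smul, Finset.mul_sum]
      rw [Finset.sum_comm]
      refine Finset.sum_congr rfl fun I _ => Finset.sum_congr rfl fun k _ => ?_
      simp [Algebra.smul_def, mul_assoc])
  funext I
  refine e.repr.injective (Finsupp.ext fun k => ?_)
  rw [Pi.zero_apply, map_zero, Finsupp.zero_apply]
  by_cases hk : k ∈ s
  · exact congrFun (h (fun I => e.repr (y I) k) (h1 k hk)) I
  · by_contra h0
    exact hk (Finset.mem_biUnion.2 ⟨I, Finset.mem_univ _, Finsupp.mem_support_iff.2 h0⟩)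

/-- Monomials in `c` are free over `K^(p)`, and monomials in `a` over a field that contains `K^(p)`
and `c`: so the products of both are free over `K^(p)`. -/
theorem IsPFree.sumElim {c : J → K} {a : J' → K} (hc : IsPFree p c) {E : Subfield K}
    (hE : ∀ x : K, x ^ p ∈ E) (hcE : ∀ j, c j ∈ E)
    (ha : LinearIndependent E fun I : J' → Fin p => ∏ j, a j ^ (I j : ℕ)) :
    IsPFree p (Sum.elim c a) := by
  intro y hy
  let e := Equiv.sumArrowEquivProdArrow J J' (Fin p)
  rw [← Equiv.sum_comp e.symm, Fintype.sum_prod_type_right] at hy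
  have h1 := Fintype.linearIndependent_iff.1 ha
    (fun I' => ⟨∑ I, (∏ j, c j ^ (I j : ℕ)) * y (e.symm (I, I')) ^ p,
      sum_mem fun I _ => mul_mem (prod_mem fun j _ => pow_mem (hcE j) _) (hE _)⟩) (by
      rw [← hy]
      refine Finset.sum_congr rfl fun I' _ => ?_
      rw [Subfield.smul_def, smul_eq_mul, Finset.sum_mul]
      refine Finset.sum_congr rfl fun I _ => ?_
      rw [Fintype.prod_sum_type]
      simp only [Sum.elim_inl, Sum.elim_inr, e, Equiv.sumArrowEquivProdArrow_symm_apply_inl,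
        Equiv.sumArrowEquivProdArrow_symm_apply_inr]
      ring)
  funext I
  have h2 := hc _ (congrArg Subtype.val (h1 (e I).2))
  simpa using congrFun h2 (e I).1

end PFree

/-! ### Expansions with respect to the field of `p`-th powers -/

section Expansion

variable {p : ℕ} {K J : Type*} [Field K]

/-- The products of a monomial in `d` and a `p`-th power of an element of `G`. -/
def monomialPow (p : ℕ) (G : Subfield K) (d : J → K) : Submonoid K where
  carrier := {z | ∃ (I : J →₀ ℕ) (y : K), y ∈ G ∧ z = (I.prod fun j e => d j ^ e) * y ^ p}
  one_mem' := ⟨0, 1, one_mem _, by simp⟩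
  mul_mem' := by
    classical
    rintro _ _ ⟨I, y, hy, rfl⟩ ⟨I', y', hy', rfl⟩
    refine ⟨I + I', y * y', mul_mem hy hy', ?_⟩
    rw [Finsupp.prod_add_index' (by simp) (by simp [pow_add])]
    ring

/-- The elements of the field `G^(p)(d)`, for `d` in `G`, are already polynomials in `d`, since
`x⁻¹ = x^(p-1) (x⁻¹)^p`. -/
theorem mem_closure_monomialPow [ExpChar K p] (hp : p.Prime) {G : Subfield K} {d : J → K}
    (hd : ∀ j, d j ∈ G) {x : K}
    (hx : x ∈ Subfield.closure ({y | ∃ z ∈ G, z ^ p = y} ∪ Set.range d)) :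
    x ∈ AddSubmonoid.closure (monomialPow p G d : Set K) := by
  suffices h : x ∈ (monomialPow p G d).subsemiringClosure ∧ x ∈ G by
    rw [← SetLike.mem_coe, ← Submonoid.subsemiringClosure_coe]
    exact h.1
  have hmem : ∀ {z}, z ∈ monomialPow p G d → z ∈ (monomialPow p G d).subsemiringClosure :=
    fun {z} hz => by
      have := AddSubmonoid.subset_closure hz
      rwa [← Submonoid.subsemiringClosure_coe] at this
  have hpow : ∀ {z}, z ∈ G → z ^ p ∈ (monomialPow p G d).subsemiringClosure := fun {z} hz =>
    hmem ⟨0, z, hz, by simp⟩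
  induction hx using Subfield.closure_induction with
  | mem x hx =>
    rcases hx with ⟨z, hz, rfl⟩ | ⟨j, rfl⟩
    · exact ⟨hpow hz, pow_mem hz p⟩
    · exact ⟨hmem ⟨Finsupp.single j 1, 1, one_mem _, by simp⟩, hd j⟩
  | one => exact ⟨one_mem _, one_mem _⟩
  | add x y _ _ hx hy => exact ⟨add_mem hx.1 hy.1, add_mem hx.2 hy.2⟩
  | neg x _ hx =>
    refine ⟨?_, neg_mem hx.2⟩
    have h1 : (-1 : K) = (-1) ^ p := by
      rw [← frobenius_def, map_neg, map_one]
    rw [neg_eq_neg_one_mul, h1]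
    exact mul_mem (hpow (neg_mem (one_mem _))) hx.1
  | inv x _ hx =>
    refine ⟨?_, inv_mem hx.2⟩
    rcases eq_or_ne x 0 with rfl | h0
    · simp
    have h1 : x⁻¹ = x ^ (p - 1) * x⁻¹ ^ p := by
      obtain ⟨q, rfl⟩ := Nat.exists_eq_succ_of_ne_zero hp.ne_zero
      rw [Nat.succ_sub_one, pow_succ, ← mul_assoc, ← mul_pow, mul_inv_cancel₀ h0, one_pow, one_mul]
    rw [h1]
    exact mul_mem (pow_mem hx.1 _) (hpow (inv_mem hx.2))
  | mul x y _ _ hx hy => exact ⟨mul_mem hx.1 hy.1, mul_mem hx.2 hy.2⟩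

/-- Reduction of all exponents modulo `p`. -/
theorem exists_isLambdaExpansion [ExpChar K p] (hp : p.Prime) {d : J → K} {x : K}
    (hx : x ∈ AddSubmonoid.closure (monomialPow p ⊤ d : Set K)) :
    ∃ l, IsLambdaExpansion p d x l := by
  classical
  induction hx using AddSubmonoid.closure_induction with
  | zero => exact ⟨0, by simp, by simp⟩
  | mem x hx =>
    obtain ⟨I, y, -, rfl⟩ := hx
    refine ⟨Finsupp.single (I.mapRange (· % p) (Nat.zero_mod p))
      ((I.prod fun j e => d j ^ (e / p)) * y), ?_, ?_⟩
    · intro I' hI' j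
      rw [Finset.mem_singleton.1 (Finsupp.support_single_subset hI')]
      exact Nat.mod_lt _ hp.pos
    · rw [Finsupp.sum_single_index (by simp [hp.ne_zero]),
        Finsupp.prod_mapRange_index (by simp), mul_pow, ← mul_assoc]
      congr 1
      simp only [Finsupp.prod]
      rw [← Finset.prod_pow, ← Finset.prod_mul_distrib]
      refine Finset.prod_congr rfl fun j _ => ?_
      rw [← pow_mul, ← pow_add, Nat.mod_add_div']
  | add x y _ _ hx hy =>
    obtain ⟨l, hl, rfl⟩ := hx
    obtain ⟨l', hl', rfl⟩ := hy
    refine ⟨l + l', fun I hI j => ?_, ?_⟩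
    · rcases Finset.mem_union.1 (Finsupp.support_add hI) with h | h
      exacts [hl I h j, hl' I h j]
    · rw [Finsupp.sum_add_index' (by simp [hp.ne_zero])]
      intro I y y'
      rw [← mul_add]
      congr 1
      exact map_add (frobenius K p) y y'

/-- For a finite family `d` in `G`, the reduced expansion has coefficients in `G`. -/
theorem exists_sum_monomials [ExpChar K p] (hp : p.Prime) [Fintype J] [DecidableEq J]
    {G : Subfield K} {d : J → K} (hd : ∀ j, d j ∈ G) {x : K}
    (hx : x ∈ AddSubmonoid.closure (monomialPow p G d : Set K)) :
    ∃ g : (J → Fin p) → K, (∀ I, g I ∈ G) ∧ x = ∑ I, (∏ j, d j ^ (I j : ℕ)) * g I ^ p := by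
  induction hx using AddSubmonoid.closure_induction with
  | zero => exact ⟨0, fun _ => zero_mem _, by simp [hp.ne_zero]⟩
  | mem x hx =>
    obtain ⟨I, y, hy, rfl⟩ := hx
    refine ⟨Pi.single (fun j => ⟨I j % p, Nat.mod_lt _ hp.pos⟩) ((∏ j, d j ^ (I j / p)) * y),
      ?_, ?_⟩
    · intro I'
      rw [Pi.single_apply]
      split_ifs
      · exact mul_mem (prod_mem fun j _ => pow_mem (hd j) _) hy
      · exact zero_mem _
    · rw [Finset.sum_eq_single (fun j => ⟨I j % p, Nat.mod_lt _ hp.pos⟩)]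
      · rw [Pi.single_eq_same, mul_pow, ← mul_assoc]
        congr 1
        rw [Finsupp.prod_fintype _ _ (by simp), ← Finset.prod_pow, ← Finset.prod_mul_distrib]
        refine Finset.prod_congr rfl fun j _ => ?_
        rw [← pow_mul, ← pow_add, Nat.mod_add_div']
      · intro I' _ h
        rw [Pi.single_eq_of_ne h, zero_pow hp.ne_zero, mul_zero]
      · simp
  | add x y _ _ hx hy =>
    obtain ⟨g, hg, rfl⟩ := hx
    obtain ⟨g', hg', rfl⟩ := hy
    refine ⟨g + g', fun I => add_mem (hg I) (hg' I), ?_⟩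
    rw [← Finset.sum_add_distrib]
    refine Finset.sum_congr rfl fun I _ => ?_
    rw [← mul_add]
    congr 1
    exact (map_add (frobenius K p) _ _).symm

end Expansion

/-! ### The chain of splitting pairs -/

section Chain

variable {p : ℕ} {K : Type*} [Field K]

theorem exists_forall_mem_closure_union {κ ι : Type*} [Finite ι] [Nonempty κ] [Preorder κ]
    [IsDirectedOrder κ] {S : κ → Set K} (hS : Monotone S) (T : Set K) {x : ι → K}
    (hx : ∀ i, x i ∈ Subfield.closure (T ∪ ⋃ k, S k)) :
    ∃ k, ∀ i, x i ∈ Subfield.closure (T ∪ S k) := by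
  have hmono : Monotone fun k => Subfield.closure (T ∪ S k) := fun k l h =>
    Subfield.closure_mono (Set.union_subset_union_right _ (hS h))
  have h1 : ∀ i, ∃ k, x i ∈ Subfield.closure (T ∪ S k) := fun i => by
    rw [← Subfield.mem_iSup_of_directed hmono.directed_le, ← Subfield.closure_iUnion,
      ← Set.union_iUnion]
    exact hx i
  choose f hf using h1
  obtain ⟨k, hk⟩ := Finite.exists_le f
  exact ⟨k, fun i => hmono (hk i) (hf i)⟩

/-- Every element of the list `l` is `p`-independent over the subfield `D` together with the
elements that precede it. -/
def IsSeqPIndependent (p : ℕ) (D : Subfield K) (l : List K) : Prop :=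
  ∀ (i : ℕ) (hi : i < l.length), l[i] ∉ pSpan p D {y | y ∈ l.take i}

theorem IsSeqPIndependent.append_singleton {D : Subfield K} {l : List K} {x : K}
    (hl : IsSeqPIndependent p D l) (hx : x ∉ pSpan p D {y | y ∈ l}) :
    IsSeqPIndependent p D (l ++ [x]) := by
  intro i hi
  rw [List.length_append, List.length_singleton] at hi
  rcases Nat.lt_succ_iff_lt_or_eq.1 hi with h | rfl
  · rw [List.getElem_append_left h, List.take_append_of_le_length h.le]
    exact hl i h
  · simpa using hx

theorem pSpan_closure_union (D : Subfield K) (S T : Set K) :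
    pSpan p (Subfield.closure ((D : Set K) ∪ S)) T = pSpan p D (S ∪ T) := by
  unfold pSpan
  apply le_antisymm
  · refine Subfield.closure_le.2 ?_
    rintro x ((hx | hx) | hx)
    · exact Subfield.subset_closure (.inl (.inl hx))
    · refine Subfield.closure_mono ?_ hx
      rintro y (hy | hy)
      exacts [.inl (.inr hy), .inr (.inl hy)]
    · exact Subfield.subset_closure (.inr (.inr hx))
  · refine Subfield.closure_le.2 ?_
    rintro x ((hx | hx) | hx | hx)
    · exact Subfield.subset_closure (.inl (.inl hx))
    · exact Subfield.subset_closure (.inl (.inr (Subfield.subset_closure (.inl hx))))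
    · exact Subfield.subset_closure (.inl (.inr (Subfield.subset_closure (.inr hx))))
    · exact Subfield.subset_closure (.inr hx)

open Classical in
theorem isSeqPIndependent_foldl {D D' : Subfield K} {A : List K}
    (hD : D' = Subfield.closure ((D : Set K) ∪ {y | y ∈ A})) (B acc : List K)
    (h : IsSeqPIndependent p D (A ++ acc)) :
    IsSeqPIndependent p D
      (A ++ B.foldl
        (fun acc x => if x ∈ pSpan p D' {y | y ∈ acc} then acc else acc ++ [x]) acc) := by
  induction B generalizing acc with
  | nil => exact h
  | cons x B ih =>
    rw [List.foldl_cons]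
    apply ih
    split_ifs with hx
    · exact h
    · rw [← List.append_assoc]
      refine h.append_singleton ?_
      rw [hD, pSpan_closure_union] at hx
      convert hx using 3
      ext y
      simp

theorem IsSeqPIndependent.append_pInd {D : Subfield K} {A : List K}
    (h : IsSeqPIndependent p D A) (B : List K) :
    IsSeqPIndependent p D
      (A ++ pInd p (Subfield.closure ((D : Set K) ∪ {y | y ∈ A})) B) :=
  isSeqPIndependent_foldl rfl B [] (by simpa using h)

open Classical in
/-- The greedy choice keeps what it has accumulated, and its result `p`-spans the given list. -/
theorem foldl_pInd_spec (D : Subfield K) (B acc : List K) :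
    (∀ y ∈ acc, y ∈ B.foldl
      (fun acc x => if x ∈ pSpan p D {y | y ∈ acc} then acc else acc ++ [x]) acc) ∧
    ∀ x ∈ B, x ∈ pSpan p D {y | y ∈ B.foldl
      (fun acc x => if x ∈ pSpan p D {y | y ∈ acc} then acc else acc ++ [x]) acc} := by
  induction B generalizing acc with
  | nil => simp
  | cons x B ih =>
    rw [List.foldl_cons]
    set acc' := if x ∈ pSpan p D {y | y ∈ acc} then acc else acc ++ [x] with hacc'
    have h1 : ∀ y ∈ acc, y ∈ acc' := by
      intro y hy
      rw [hacc']
      split_ifs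
      · exact hy
      · exact List.mem_append_left _ hy
    have h2 : x ∈ pSpan p D {y | y ∈ acc'} := by
      rw [hacc']
      split_ifs with h
      · exact h
      · exact Subfield.subset_closure (.inr (by simp))
    refine ⟨fun y hy => (ih acc').1 y (h1 y hy), fun z hz => ?_⟩
    rcases List.mem_cons.1 hz with rfl | hz
    · exact Subfield.closure_mono (Set.union_subset_union_right _ (ih acc').1) h2
    · exact (ih acc').2 z hz

theorem mem_pSpan_pInd {D : Subfield K} {B : List K} {x : K} (hx : x ∈ B) :
    x ∈ pSpan p D {y | y ∈ pInd p D B} :=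
  (foldl_pInd_spec D B []).2 x hx

variable {ι : Type*} {C : Subfield K} {c : ι → C}

/-- `C = C^(p)(c)`, read inside an overfield. -/
theorem coe_mem_closure_of_isPBasis (hc : IsPBasis p (⊥ : Subfield C) (Set.range c))
    {G : Subfield K} (hCG : C ≤ G) (x : C) :
    (x : K) ∈ Subfield.closure ({y | ∃ z ∈ G, z ^ p = y} ∪ Set.range fun i => (c i : K)) := by
  have h : pSpan p (⊥ : Subfield C) (Set.range c) ≤
      (Subfield.closure ({y | ∃ z ∈ G, z ^ p = y} ∪ Set.range fun i => (c i : K))).comap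
        C.subtype := by
    refine Subfield.closure_le.2 ?_
    rintro y ((⟨z, rfl⟩ | hy) | ⟨i, rfl⟩)
    · exact Subfield.subset_closure (.inl ⟨z, hCG z.2, rfl⟩)
    · exact (bot_le : (⊥ : Subfield C) ≤ _) hy
    · exact Subfield.subset_closure (.inr ⟨i, rfl⟩)
  exact h (hc.2 ▸ Subfield.mem_top x)

/-- By maximality of the `p`-independent set chosen from `B`, the lambda functions used in a
splitting pair are defined on `B`, so that `lambdaCoeff` does not take its default value. -/
theorem exists_isLambdaExpansion_of_mem [ExpChar K p] (hp : p.Prime)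
    (hc : IsPBasis p (⊥ : Subfield C) (Set.range c)) (A : List K) {B : List K} {x : K}
    (hx : x ∈ B) :
    ∃ l, IsLambdaExpansion p (concatFamily c
      (A ++ pInd p (Subfield.closure ((C : Set K) ∪ {y | y ∈ A})) B)) x l := by
  set A' := A ++ pInd p (Subfield.closure ((C : Set K) ∪ {y | y ∈ A})) B with hA'
  refine exists_isLambdaExpansion hp (mem_closure_monomialPow hp (fun _ => Subfield.mem_top _) ?_)
  have h1 := mem_pSpan_pInd (p := p) (D := Subfield.closure ((C : Set K) ∪ {y | y ∈ A})) hx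
  rw [pSpan_closure_union] at h1
  refine (Subfield.closure_le.2 ?_ : _ ≤ _) h1
  have hmem : ∀ y ∈ A', y ∈ Set.range (concatFamily c A') := by
    intro y hy
    obtain ⟨i, rfl⟩ := List.mem_iff_get.1 hy
    exact ⟨toLex (.inr i), rfl⟩
  rintro y ((⟨z, rfl⟩ | hy) | hy)
  · exact Subfield.subset_closure (.inl ⟨z, Subfield.mem_top _, rfl⟩)
  · refine Subfield.closure_mono (Set.union_subset_union_right _ ?_)
      (coe_mem_closure_of_isPBasis hc le_top ⟨y, hy⟩)
    rintro _ ⟨i, rfl⟩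
    exact ⟨toLex (.inl i), rfl⟩
  · refine Subfield.subset_closure (.inr (hmem y ?_))
    rw [hA', List.mem_append]
    exact hy

variable [LinearOrder ι] (c)

theorem lambdaChain_succ (a : List K) (k : ℕ) :
    lambdaChain p c a (k + 1) = splitPair p c (lambdaChain p c a k) :=
  Function.iterate_succ_apply' _ _ _

theorem isSeqPIndependent_lambdaChain (a : List K) (k : ℕ) :
    IsSeqPIndependent p C (lambdaChain p c a k).1 := by
  induction k with
  | zero => intro i hi; simp [lambdaChain] at hi
  | succ k ih =>
    rw [lambdaChain_succ]
    exact ih.append_pInd _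

theorem monotone_lambdaChain_fst (a : List K) :
    Monotone fun k => {y | y ∈ (lambdaChain p c a k).1} := by
  refine monotone_nat_of_le_succ fun k x hx => ?_
  rw [Set.mem_ofPred, lambdaChain_succ]
  exact List.mem_append_left _ hx

theorem monotone_lambdaChain_snd (a : List K) :
    Monotone fun k => {y | y ∈ (lambdaChain p c a k).2} := by
  refine monotone_nat_of_le_succ fun k x hx => ?_
  rw [Set.mem_ofPred, lambdaChain_succ]
  exact List.mem_append_left _ hx

theorem monotone_lambdaStage (a : List K) : Monotone (lambdaStage p c a) := by
  rintro k l h x (hx | hx)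
  exacts [.inl (monotone_lambdaChain_fst c a h hx), .inr (monotone_lambdaChain_snd c a h hx)]

variable {c}

theorem lambdaCoeff_mem_lambdaList {J : Type*} [LinearOrder J] {d : J → K} {x : K} {I : J →₀ ℕ}
    (hI : I ∈ (lambdaCoeff p d x).support) : lambdaCoeff p d x I ∈ lambdaList p d x := by
  classical
  refine List.mem_append_left _ (List.mem_map.2 ⟨toLex I, ?_, rfl⟩)
  simpa using hI

/-- The elements of the second component of a pair are polynomials in `c` and in the first component
of the next pair, the coefficients being `p`-th powers of elements of its second component. -/
theorem mem_closure_lambdaChain [ExpChar K p] (hp : p.Prime)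
    (hc : IsPBasis p (⊥ : Subfield C) (Set.range c)) {a : List K} {G : Subfield K}
    (hG : ∀ k, lambdaStage p c a k ⊆ G) {k : ℕ} {x : K} (hx : x ∈ (lambdaChain p c a k).2) :
    x ∈ Subfield.closure ({y | ∃ z ∈ G, z ^ p = y} ∪
      ((Set.range fun i => (c i : K)) ∪ ⋃ k, {y | y ∈ (lambdaChain p c a k).1})) := by
  have hex := exists_isLambdaExpansion_of_mem hp hc (lambdaChain p c a k).1 hx
  have hA : (lambdaChain p c a k).1 ++ pInd p (Subfield.closure ((C : Set K) ∪
      {y | y ∈ (lambdaChain p c a k).1})) (lambdaChain p c a k).2 =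
      (lambdaChain p c a (k + 1)).1 := by
    rw [lambdaChain_succ]; rfl
  have hB : (lambdaChain p c a (k + 1)).2 = (lambdaChain p c a k).2 ++
      (lambdaChain p c a k).2.flatMap
        (lambdaList p (concatFamily c (lambdaChain p c a (k + 1)).1)) := by
    rw [lambdaChain_succ]; rfl
  rw [hA] at hex
  set d := concatFamily c (lambdaChain p c a (k + 1)).1 with hd
  have hspec : IsLambdaExpansion p d x (lambdaCoeff p d x) := by
    rw [lambdaCoeff, dif_pos hex]
    exact hex.choose_spec
  rw [hspec.2]
  refine sum_mem fun I hI => mul_mem (prod_mem fun j _ => pow_mem ?_ _) ?_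
  · refine Subfield.subset_closure (.inr ?_)
    induction j with | _ j
    rcases j with i | i
    · exact .inl ⟨i, rfl⟩
    · exact .inr (Set.mem_iUnion.2 ⟨k + 1, List.get_mem _ i⟩)
  · refine Subfield.subset_closure (.inl ⟨_, hG (k + 1) (.inr ?_), rfl⟩)
    rw [hB]
    exact List.mem_append_right _ (List.mem_flatMap.2 ⟨x, hx, lambdaCoeff_mem_lambdaList hI⟩)

/-- The monomials in finitely many elements of `c` and of the first component of a pair in the chain
are linearly independent over `K^(p)`. -/
theorem isPFree_lambdaChain [ExpChar K p] (hp : p.Prime) (hCK : PreservesIndepPow p C K)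
    (hc_inj : Function.Injective c) (hc : IsPBasis p (⊥ : Subfield C) (Set.range c))
    (a : List K) (k : ℕ) (s : Finset ι) :
    IsPFree p (Sum.elim (fun i : s => (c i : K)) (lambdaChain p c a k).1.get) := by
  have : ExpChar C p := (algebraMap C K).expChar (algebraMap C K).injective p
  have h1 : IsPFree p fun i : s => c i :=
    hc.1.isPFree hp (hc_inj.comp Subtype.val_injective) fun j => ⟨j, rfl⟩
  have hpow : ∀ x : K, x ^ p ∈ pSpan p C ∅ := fun x =>
    Subfield.subset_closure (.inl (.inl ⟨x, rfl⟩))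
  have hC : ∀ x ∈ C, x ∈ pSpan p C ∅ := fun x hx => Subfield.subset_closure (.inl (.inr hx))
  refine (h1.map hCK).sumElim hpow (fun j => hC _ (c j).2) (linearIndependent_monomials hp
    (fun x => ⟨⟨x ^ p, hpow x⟩, rfl⟩) _ fun i hi => ?_)
  refine isSeqPIndependent_lambdaChain c a k i i.2 ?_
  refine (Subfield.closure_le (t := pSpan p C _)).2 ?_ hi
  rintro _ (⟨y, rfl⟩ | ⟨j, hj, rfl⟩)
  · exact Subfield.closure_mono (Set.union_subset_union_right _ (Set.empty_subset _)) y.2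
  · refine Subfield.subset_closure (.inr ?_)
    rw [Set.mem_ofPred, List.mem_take_iff_getElem]
    exact ⟨j, lt_min (Fin.lt_def.1 hj) j.2, rfl⟩

/-- Being closed under the lambda functions, the union of the chain generates a subfield over which
`K` is separable. -/
theorem preservesIndepPow_adjoin_iUnion_lambdaStage [ExpChar K p] (hp : p.Prime)
    (hCK : PreservesIndepPow p C K) (hc_inj : Function.Injective c)
    (hc : IsPBasis p (⊥ : Subfield C) (Set.range c)) (a : List K) :
    PreservesIndepPow p (IntermediateField.adjoin C (⋃ k, lambdaStage p c a k)) K := by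
  classical
  set F := IntermediateField.adjoin C (⋃ k, lambdaStage p c a k) with hF
  have hCF : C ≤ F.toSubfield := fun x hx => F.algebraMap_mem ⟨x, hx⟩
  have hstage : ∀ k, lambdaStage p c a k ⊆ F.toSubfield := fun k x hx =>
    IntermediateField.subset_adjoin _ _ (Set.mem_iUnion.2 ⟨k, hx⟩)
  have hgen : F.toSubfield ≤ Subfield.closure ({y | ∃ z ∈ F.toSubfield, z ^ p = y} ∪
      ((Set.range fun i => (c i : K)) ∪ ⋃ k, {y | y ∈ (lambdaChain p c a k).1})) := by
    refine Subfield.closure_le.2 ?_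
    rintro _ (⟨x, rfl⟩ | hx)
    · exact Subfield.closure_mono (Set.union_subset_union_right _ Set.subset_union_left)
        (coe_mem_closure_of_isPBasis hc hCF x)
    · obtain ⟨k, hx | hx⟩ := Set.mem_iUnion.1 hx
      · exact Subfield.subset_closure (.inr (.inr (Set.mem_iUnion.2 ⟨k, hx⟩)))
      · exact mem_closure_lambdaChain hp hc hstage hx
  let S : Finset ι × ℕ → Set K := fun q =>
    (fun i => (c i : K)) '' q.1 ∪ {y | y ∈ (lambdaChain p c a q.2).1}
  have hS : Monotone S := fun q r h => Set.union_subset_union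
    (Set.image_mono (Finset.coe_subset.2 h.1)) (monotone_lambdaChain_fst c a h.2)
  have hSU : (Set.range fun i => (c i : K)) ∪ (⋃ k, {y | y ∈ (lambdaChain p c a k).1}) ⊆
      ⋃ q, S q := by
    rintro x (⟨i, rfl⟩ | hx)
    · exact Set.mem_iUnion.2 ⟨({i}, 0), .inl ⟨i, by simp, rfl⟩⟩
    · obtain ⟨k, hx⟩ := Set.mem_iUnion.1 hx
      exact Set.mem_iUnion.2 ⟨(∅, k), .inr hx⟩
  intro n x hx
  rw [Fintype.linearIndependent_iff] at hx ⊢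
  intro f hf
  obtain ⟨⟨s, k⟩, hsk⟩ := exists_forall_mem_closure_union hS {y | ∃ z ∈ F.toSubfield, z ^ p = y}
    (x := fun i => (f i : K)) fun i =>
      Subfield.closure_mono (Set.union_subset_union_right _ hSU) (hgen (f i).2)
  let d : s ⊕ Fin (lambdaChain p c a k).1.length → K :=
    Sum.elim (fun i : s => (c i : K)) (lambdaChain p c a k).1.get
  have hdF : ∀ j, d j ∈ F.toSubfield := by
    rintro (i | i)
    · exact hCF (c i).2
    · exact hstage k (.inl (List.get_mem _ i))
  have hex : ∀ i, ∃ g : (s ⊕ Fin (lambdaChain p c a k).1.length → Fin p) → K,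
      (∀ I, g I ∈ F.toSubfield) ∧ (f i : K) = ∑ I, (∏ j, d j ^ (I j : ℕ)) * g I ^ p := by
    intro i
    refine exists_sum_monomials hp hdF (mem_closure_monomialPow hp hdF ?_)
    refine Subfield.closure_mono (Set.union_subset_union_right _ ?_) (hsk i)
    rintro _ (⟨i, hi, rfl⟩ | hx)
    · exact ⟨.inl ⟨i, hi⟩, rfl⟩
    · obtain ⟨i, rfl⟩ := List.mem_iff_get.1 hx
      exact ⟨.inr i, rfl⟩
  choose g hgF hg using hex
  -- The relation `∑ fᵢ xᵢ^p = 0` becomes `∑_I d^I (∑ᵢ gᵢ_I xᵢ)^p = 0`.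
  have hfree := isPFree_lambdaChain hp hCK hc_inj hc a k s
  have h1 := hfree (fun I => ∑ i, g i I * x i) (by
    rw [← hf]
    simp_rw [IntermediateField.smul_def, smul_eq_mul, hg, Finset.sum_mul]
    rw [Finset.sum_comm]
    refine Finset.sum_congr rfl fun I _ => ?_
    rw [← frobenius_def, map_sum, Finset.mul_sum]
    refine Finset.sum_congr rfl fun i _ => ?_
    rw [frobenius_def, mul_pow, ← mul_assoc])
  intro i
  refine Subtype.ext ?_
  rw [hg i]
  refine Finset.sum_eq_zero fun I _ => ?_
  have h2 := hx (fun i => ⟨g i I, hgF i I⟩) (congrFun h1 I) i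
  have h3 : g i I = 0 := congrArg Subtype.val h2
  rw [h3, zero_pow hp.ne_zero, mul_zero]

end Chain

/-! ### The chain reaches a field over which `b` is separable -/

section Termination

variable {p : ℕ} {K : Type*} [Field K] {C : Subfield K}

/-- A separable equation involves finitely many coefficients, so it is defined at a finite stage. -/
theorem isSeparable_adjoin_of_iUnion {S : ℕ → Set K} (hS : Monotone S) {σ : Type*} {t : σ → K}
    {x : K} (hx : IsSeparable (IntermediateField.adjoin (IntermediateField.adjoin C (⋃ k, S k))
      (Set.range t)) x) :
    ∃ k, ∀ l ≥ k, IsSeparable (IntermediateField.adjoin (IntermediateField.adjoin C (S l))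
      (Set.range t)) x := by
  obtain ⟨f, hf, hf0, hfc⟩ := isSeparable_iff_exists_polynomial.1 hx
  have h1 : ∀ i : Fin (f.natDegree + 1), f.coeff i ∈
      Subfield.closure (((C : Set K) ∪ Set.range t) ∪ ⋃ k, S k) := by
    intro i
    obtain ⟨⟨y, hy⟩, hi⟩ := hfc i
    rw [← hi]
    refine (Subfield.closure_le.2 ?_ : _ ≤ _) hy
    rintro _ (⟨⟨z, hz⟩, rfl⟩ | hz)
    · refine (Subfield.closure_le.2 ?_ : _ ≤ _) hz
      rintro _ (⟨w, rfl⟩ | hw)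
      · exact Subfield.subset_closure (.inl (.inl w.2))
      · exact Subfield.subset_closure (.inr hw)
    · exact Subfield.subset_closure (.inl (.inr hz))
  obtain ⟨k, hk⟩ := exists_forall_mem_closure_union hS _ h1
  refine ⟨k, fun l hl => isSeparable_iff_exists_polynomial.2 ⟨f, hf, hf0, fun i => ?_⟩⟩
  by_cases hi : i < f.natDegree + 1
  · refine ⟨⟨f.coeff i, ?_⟩, rfl⟩
    refine (Subfield.closure_le (t := (IntermediateField.adjoin (IntermediateField.adjoin C (S l))
      (Set.range t)).toSubfield)).2 ?_ (hk ⟨i, hi⟩)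
    rintro z ((hz | hz) | hz)
    · exact IntermediateField.algebraMap_mem _
        (⟨z, IntermediateField.algebraMap_mem _ (⟨z, hz⟩ : C)⟩ :
        IntermediateField.adjoin C (S l))
    · exact IntermediateField.subset_adjoin _ _ hz
    · exact IntermediateField.algebraMap_mem _
        (⟨z, IntermediateField.subset_adjoin _ _ (hS hl hz)⟩ :
        IntermediateField.adjoin C (S l))
  · rw [Polynomial.coeff_eq_zero_of_natDegree_lt (by omega)]
    exact ⟨0, map_zero _⟩

/-- The chain of splitting pairs reaches a field over which the given tuple is separable. -/
theorem exists_isSeparableOver_lambdaStage [ExpChar K p] (hC : IsSeparableExtension p C K)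
    {ι : Type*} [LinearOrder ι] {c : ι → C} (hc_inj : Function.Injective c)
    (hc : IsPBasis p (⊥ : Subfield C) (Set.range c)) (a : List K) {n : ℕ} (b : Fin n → K) :
    ∃ k, IsSeparableOver p C (lambdaStage p c a k) b := by
  have hchar : ∀ S : Set K, ExpChar (IntermediateField.adjoin C S) p := fun S =>
    (algebraMap (IntermediateField.adjoin C S) K).expChar
      (algebraMap (IntermediateField.adjoin C S) K).injective p
  have hCchar : ExpChar C p := (algebraMap C K).expChar (algebraMap C K).injective p
  by_cases hp : p.Prime
  · have h1 := preservesIndepPow_adjoin_iUnion_lambdaStage hp (isSeparableExtension_iff.1 hC)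
      hc_inj hc a
    set F := IntermediateField.adjoin C (⋃ k, lambdaStage p c a k) with hF
    have : ExpChar F p := hchar _
    have : Algebra.EssFiniteType F (IntermediateField.adjoin F (Set.range b)) :=
      (IntermediateField.essFiniteType_iff).2 (IntermediateField.fg_adjoin_of_finite
        (Set.finite_range b))
    obtain ⟨r, t, ht, hsep⟩ := (h1.of_injective (IntermediateField.adjoin F (Set.range b)).val
      Subtype.val_injective).exists_separating
    choose k hk using fun j => isSeparable_adjoin_of_iUnion (monotone_lambdaStage c a)
      (hsep (b j) (IntermediateField.subset_adjoin _ _ ⟨j, rfl⟩))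
    obtain ⟨l, hl⟩ := Finite.exists_le k
    refine ⟨l, ?_⟩
    have := hchar (lambdaStage p c a l)
    refine isSeparableExtension_iff.2 (.of_separating (t := t) ?_ fun j => hk j l (hl j))
    have hle : IntermediateField.adjoin C (lambdaStage p c a l) ≤ F :=
      IntermediateField.adjoin.mono _ _ _ (Set.subset_iUnion _ l)
    let := (IntermediateField.inclusion hle).toRingHom.toAlgebra
    have : IsScalarTower (IntermediateField.adjoin C (lambdaStage p c a l)) F K :=
      IsScalarTower.of_algebraMap_eq fun _ => rfl
    exact ht.restrictScalars (IntermediateField.inclusion_injective hle)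
  -- In characteristic exponent `1` every extension is separable.
  · refine ⟨0, ?_⟩
    have := hchar (lambdaStage p c a 0)
    refine isSeparableExtension_iff.2 fun n x hx => ?_
    have hp1 : p = 1 := (expChar_is_prime_or_one K p).resolve_left hp
    simpa [hp1] using hx

end Termination

/-! ### Henselian topologies -/

section Henselian

namespace LocalFormula

/-- The formula `∀ v ∈ U^m, φ(v, U)` for a free set variable `U`. -/
noncomputable def allMem : (m : ℕ) → LocalFormula m 0 1 → LocalFormula 0 0 1
  | 0, φ => φ
  | m + 1, φ => allMem m (.all (.or (.notMem (MvPolynomial.X (Fin.last m)) 0) φ))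

theorem realize_allMem {R : Type*} [CommRing R] (τ : TopologicalSpace R) (N : Fin 1 → Set R) (m : ℕ)
    (φ : LocalFormula m 0 1) :
    (allMem m φ).Realize R τ Fin.elim0 Fin.elim0 N ↔
      ∀ v : Fin m → R, (∀ i, v i ∈ N 0) → φ.Realize R τ v Fin.elim0 N := by
  induction m with
  | zero =>
    rw [allMem]
    refine ⟨fun h v _ => ?_, fun h => h _ fun i => i.elim0⟩
    rwa [Subsingleton.elim v Fin.elim0]
  | succ m ih =>
    rw [allMem, ih]
    constructor
    · intro h v hv
      rcases h (Fin.init v) (fun i => hv _) (v (Fin.last m)) with h | h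
      · simp only [Realize, MvPolynomial.aeval_X, Fin.snoc_last] at h
        exact absurd (hv _) h
      · rwa [Fin.snoc_init_self] at h
    · intro h v hv x
      by_cases hx : x ∈ N 0
      · refine .inr (h _ fun i => ?_)
        induction i using Fin.lastCases with
        | last => simpa using hx
        | cast i => simpa using hv i
      · refine .inl ?_
        simpa only [Realize, MvPolynomial.aeval_X, Fin.snoc_last] using hx

/-- The sentence stating that points are separated from `0` by neighbourhoods of `0`. -/
noncomputable def separated : LocalFormula 0 0 0 :=
  .all (.or (.eq (MvPolynomial.X 0)) (.exNhd (.notMem (MvPolynomial.X 0) 0)))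

theorem realize_separated {R : Type*} [CommRing R] (τ : TopologicalSpace R) :
    separated.Realize R τ Fin.elim0 Fin.elim0 Fin.elim0 ↔
      ∀ x : R, x = 0 ∨ ∃ U ∈ 𝓝 (0 : R), x ∉ U := by
  simp [separated, Realize, Fin.snoc]

/-- The sentence stating that, for some neighbourhood `U` of `0`, all the polynomials
`1 + Y + ∑ ε_i Y^(i+1)` of degree at most `N` with all `ε_i ∈ U` have a root. -/
noncomputable def hensel (N : ℕ) : LocalFormula 0 0 0 :=
  .exNhd (allMem N (.ex (.eq (1 + MvPolynomial.X (Fin.last N) +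
    ∑ i : Fin N, MvPolynomial.X i.castSucc * MvPolynomial.X (Fin.last N) ^ ((i : ℕ) + 1)))))

theorem realize_hensel {R : Type*} [CommRing R] (τ : TopologicalSpace R) (N : ℕ) :
    (hensel N).Realize R τ Fin.elim0 Fin.elim0 Fin.elim0 ↔
      ∃ U ∈ 𝓝 (0 : R), ∀ v : Fin N → R, (∀ i, v i ∈ U) →
        ∃ y, 1 + y + ∑ i, v i * y ^ ((i : ℕ) + 1) = 0 := by
  simp only [hensel, Realize, realize_allMem]
  simp [Fin.snoc]

end LocalFormula

variable {L : Type*} [Field L]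

theorem setOf_valuation_lt_mem_nhds (A : ValuationSubring L) {z : L} (hz : z ≠ 0) :
    {x | A.valuation x < A.valuation z} ∈ @nhds L (valuationSubringTopology A) 0 := by
  let := Valued.mk' A.valuation
  have hz' : (Valued.v (R := L)).restrict z ≠ 0 := by
    simpa using hz
  rw [Valued.mem_nhds_zero]
  exact ⟨Units.mk0 _ hz', fun y hy => (Valuation.restrict_lt_iff _).1 hy⟩

/-- In a henselian valuation ring the reversed polynomial `Z^(N+1) + Z^N + ∑ ε_i Z^(N-i)`, with all
`ε_i` in the maximal ideal, has a root near `-1`, by Hensel's lemma. -/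
theorem HenselianLocalRing.exists_reverse_root {A : Type*} [CommRing A] [HenselianLocalRing A]
    {N : ℕ} (v : Fin N → A) (hv : ∀ i, v i ∈ IsLocalRing.maximalIdeal A) :
    ∃ z : A, IsUnit z ∧ z ^ (N + 1) + z ^ N + ∑ i, v i * z ^ (N - i) = 0 := by
  let g : Polynomial A := Polynomial.X ^ N + ∑ i, Polynomial.C (v i) * Polynomial.X ^ (N - i)
  have hdeg : g.degree < (N + 1 : ℕ) := by
    refine (Polynomial.degree_add_le _ _).trans_lt (max_lt ?_ ?_)
    · exact (Polynomial.degree_X_pow_le N).trans_lt (by exact_mod_cast Nat.lt_succ_self N)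
    · refine (Polynomial.degree_sum_le _ _).trans_lt
        ((Finset.sup_lt_iff (WithBot.bot_lt_coe _)).2 ?_)
      intro i _
      refine (Polynomial.degree_C_mul_X_pow_le _ _).trans_lt ?_
      exact_mod_cast Nat.lt_succ_of_le (Nat.sub_le _ _)
  have hmonic : (Polynomial.X ^ (N + 1) + g).Monic := Polynomial.monic_X_pow_add hdeg
  have hev : ∀ z, (Polynomial.X ^ (N + 1) + g).eval z =
      z ^ (N + 1) + z ^ N + ∑ i, v i * z ^ (N - i) := fun z => by
    simp [g, Polynomial.eval_finsetSum, add_assoc]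
  obtain ⟨z, hz, hz1⟩ := HenselianLocalRing.is_henselian _ hmonic (-1) (by
      rw [hev, pow_succ, mul_neg_one, neg_add_cancel, zero_add]
      exact sum_mem fun i _ => Ideal.mul_mem_right _ _ (hv i)) (by
      have h1 : (Polynomial.X ^ (N + 1) + g).derivative.eval (-1) = (-1) ^ N +
          ∑ i, v i * (Polynomial.derivative (Polynomial.X ^ (N - (i : ℕ)) : Polynomial A)).eval (-1)
          := by
        simp only [g, Polynomial.derivative_add, Polynomial.derivative_sum,
          Polynomial.derivative_C_mul, Polynomial.eval_add, Polynomial.eval_finsetSum,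
          Polynomial.eval_mul, Polynomial.eval_C, ← add_assoc]
        congr 1
        rcases N with _ | N
        · simp
        · simp [pow_succ]
          ring
      rw [h1]
      by_contra h2
      have h3 := (IsLocalRing.mem_maximalIdeal _).2 h2
      have h4 := (Ideal.add_mem_iff_left _ (sum_mem fun i _ =>
        Ideal.mul_mem_right _ _ (hv i))).1 h3
      exact (IsLocalRing.mem_maximalIdeal _).1 h4 (isUnit_one.neg.pow N))
  refine ⟨z, ?_, by rw [← hev]; exact hz⟩
  by_contra h2
  have h3 := (IsLocalRing.mem_maximalIdeal _).2 h2
  have h4 := sub_mem h3 hz1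
  rw [sub_sub_cancel] at h4
  exact (IsLocalRing.mem_maximalIdeal _).1 h4 isUnit_one.neg

theorem realize_hensel_of_henselianLocalRing (A : ValuationSubring L) [HenselianLocalRing A]
    (N : ℕ) : (LocalFormula.hensel N).Realize L (valuationSubringTopology A)
      Fin.elim0 Fin.elim0 Fin.elim0 := by
  rw [LocalFormula.realize_hensel]
  refine ⟨_, setOf_valuation_lt_mem_nhds A one_ne_zero, fun v hv => ?_⟩
  have hvA : ∀ i, v i ∈ A := fun i => by
    rw [← ValuationSubring.valuation_le_one_iff]
    have := hv i
    rw [Set.mem_ofPred, map_one] at this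
    exact this.le
  obtain ⟨z, hz, h⟩ := HenselianLocalRing.exists_reverse_root (A := A) (fun i => ⟨v i, hvA i⟩)
    fun i => (A.valuation_lt_one_iff _).2 (by simpa using hv i)
  have hz0 : (z : L) ≠ 0 := fun h0 => hz.ne_zero (Subtype.ext h0)
  have h' := congrArg (A.subtype) h
  simp only [map_add, map_pow, map_sum, map_mul, map_zero, ValuationSubring.subtype_apply] at h'
  -- The root of the reversed polynomial is a unit, and its inverse is the desired root.
  refine ⟨(z : L)⁻¹, ?_⟩
  have hzN : (z : L) ^ (N + 1) ≠ 0 := pow_ne_zero _ hz0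
  refine (mul_eq_zero.1 (?_ : (z : L) ^ (N + 1) * _ = 0)).resolve_left hzN
  rw [← h', mul_add, mul_add, mul_one, Finset.mul_sum]
  congr 1
  · rw [pow_succ, mul_assoc, mul_inv_cancel₀ hz0, mul_one]
  · refine Finset.sum_congr rfl fun i _ => ?_
    have h1 : (z : L) ^ (N + 1) = z ^ (N - i) * z ^ ((i : ℕ) + 1) := by
      rw [← pow_add]
      congr 1
      omega
    rw [h1, mul_left_comm, mul_assoc, ← mul_pow, mul_inv_cancel₀ hz0, one_pow, mul_one]

theorem realize_separated_valuationSubringTopology (A : ValuationSubring L) :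
    LocalFormula.separated.Realize L (valuationSubringTopology A)
      Fin.elim0 Fin.elim0 Fin.elim0 := by
  rw [LocalFormula.realize_separated]
  intro x
  refine or_iff_not_imp_left.2 fun hx => ⟨_, setOf_valuation_lt_mem_nhds A hx, ?_⟩
  simp

variable {K : Type u} [Field K] {τ : TopologicalSpace K}

theorem IsHenselianTopology.eventually_ne_zero (hτ : IsHenselianTopology K τ) {x : K} (hx : x ≠ 0) :
    ∀ᶠ y in 𝓝 x, y ≠ 0 := by
  obtain ⟨_, L, _, A, -, -, h⟩ := hτ
  have h1 := (LocalFormula.realize_separated τ).1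
    ((h _).2 (realize_separated_valuationSubringTopology A))
  obtain ⟨U, hU, hxU⟩ := (h1 x).resolve_left hx
  have h2 : Filter.Tendsto (fun y => x - y) (𝓝 x) (𝓝 0) := by
    have : Filter.Tendsto (fun y => x - y) (𝓝 x) (𝓝 (x - x)) :=
      Continuous.tendsto (by fun_prop) x
    rwa [sub_self] at this
  filter_upwards [h2 hU] with y hy h0
  rw [h0] at hy
  exact hxU (by simpa using hy)

theorem IsHenselianTopology.exists_nhds_root (hτ : IsHenselianTopology K τ) (N : ℕ) :
    ∃ U ∈ 𝓝 (0 : K), ∀ v : Fin N → K, (∀ i, v i ∈ U) →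
      ∃ y, 1 + y + ∑ i, v i * y ^ ((i : ℕ) + 1) = 0 := by
  obtain ⟨_, L, _, A, -, _, h⟩ := hτ
  exact (LocalFormula.realize_hensel τ N).1 ((h _).2 (realize_hensel_of_henselianLocalRing A N))

/-- A root of a polynomial that is close to one with a simple root at `0`.  The substitution
`x = (c₀/u) y`, where `u` is the linear coefficient at the centre, brings the polynomial
into the form `1 + y + ∑ ε_i y^(i+1)`. -/
theorem IsHenselianTopology.eventually_exists_sum_eq_zero (hτ : IsHenselianTopology K τ)
    {Y : Type*} [TopologicalSpace Y] {e : Y} {N : ℕ} {c : ℕ → Y → K}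
    (hc : ∀ i, ContinuousAt (c i) e) (h0 : c 0 e = 0) (h1 : c 1 e ≠ 0) :
    ∀ᶠ y in 𝓝 e, ∃ x, ∑ i ∈ Finset.range (N + 2), c i y * x ^ i = 0 := by
  have := hτ.1
  obtain ⟨U, hU, hroot⟩ := hτ.exists_nhds_root (N + 1)
  set u := c 1 e
  -- The index `0` stands for the linear term, in which `y` itself is split off.
  let v : Fin (N + 1) → Y → K := fun i y =>
    c (i + 1) y * c 0 y ^ (i : ℕ) * (u⁻¹) ^ ((i : ℕ) + 1) - if i = 0 then 1 else 0
  have hv : ∀ i, ∀ᶠ y in 𝓝 e, v i y ∈ U := by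
    intro i
    have hcont : ContinuousAt (v i) e :=
      (((hc _).mul ((hc _).pow _)).mul continuousAt_const).sub continuousAt_const
    refine hcont ?_
    have : v i e = 0 := by
      rcases Fin.eq_zero_or_eq_succ i with rfl | ⟨j, rfl⟩
      · simp [v, u, h1]
      · simp [v, h0]
    rwa [this]
  filter_upwards [Filter.eventually_all.2 hv] with y hy
  obtain ⟨z, hz⟩ := hroot (fun i => v i y) hy
  refine ⟨c 0 y * u⁻¹ * z, ?_⟩
  have h2 : (1 : K) + z + ∑ i, v i y * z ^ ((i : ℕ) + 1) =
      1 + ∑ i : Fin (N + 1), c (i + 1) y * c 0 y ^ (i : ℕ) * (u⁻¹) ^ ((i : ℕ) + 1) *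
        z ^ ((i : ℕ) + 1) := by
    simp only [v, sub_mul, Finset.sum_sub_distrib]
    simp
  rw [h2] at hz
  rw [Finset.sum_range_succ', Finset.sum_range, pow_zero, mul_one, add_comm]
  refine Eq.trans ?_ (mul_eq_zero_of_right (c 0 y) hz)
  rw [mul_add, mul_one, Finset.mul_sum]
  congr 1
  refine Finset.sum_congr rfl fun i _ => ?_
  ring

/-- Simple roots persist under small changes of the coefficients. -/
theorem IsHenselianTopology.eventually_exists_root (hτ : IsHenselianTopology K τ)
    {Y : Type*} [TopologicalSpace Y] {e : Y} {N : ℕ} {Q : Y → Polynomial K}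
    (hN : ∀ y, (Q y).natDegree ≤ N) (hQ : ∀ i, ContinuousAt (fun y => (Q y).coeff i) e) {s : K}
    (hs : (Q e).eval s = 0) (hs' : (Q e).derivative.eval s ≠ 0) :
    ∀ᶠ y in 𝓝 e, ∃ x, (Q y).eval x = 0 := by
  have := hτ.1
  have hsum : ∀ y k, (Polynomial.taylor s (Q y)).coeff k = ∑ i ∈ Finset.range (N + 1),
      (Q y).coeff i * (Polynomial.taylor s (Polynomial.X ^ i)).coeff k := by
    intro y k
    conv_lhs => rw [(Q y).as_sum_range' (N + 1) (Nat.lt_succ_of_le (hN y))]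
    rw [map_sum, Polynomial.finsetSum_coeff]
    refine Finset.sum_congr rfl fun i _ => ?_
    rw [← Polynomial.C_mul_X_pow_eq_monomial, Polynomial.taylor_mul, Polynomial.taylor_C,
      Polynomial.coeff_C_mul]
  have h := hτ.eventually_exists_sum_eq_zero (N := N) (e := e)
    (c := fun k y => (Polynomial.taylor s (Q y)).coeff k)
    (fun k => by
      simp_rw [hsum]
      exact tendsto_finsetSum _ fun i _ => (hQ i).mul continuousAt_const)
    (by simpa using hs) (by simpa using hs')
  filter_upwards [h] with y ⟨x, hx⟩
  refine ⟨x + s, ?_⟩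
  rw [← Polynomial.taylor_eval, Polynomial.eval_eq_sum_range' (n := N + 2), hx]
  rw [Polynomial.natDegree_taylor]
  exact lt_of_le_of_lt (hN y) (by omega)

end Henselian

/-! ### Specialization of generic points -/

section Specialization

variable {K : Type u} [Field K] {C : Subfield K} {σ : Type*}

/-- Coordinates that are algebraically independent over `C(e)` satisfy no relations with `e`, so
they may be kept fixed when `e` is specialized. -/
theorem sumElim_mem_locus {σ' : Type*} {t : σ' → K} {e y : σ → K}
    (ht : AlgebraicIndependent (IntermediateField.adjoin C (Set.range e)) t) (hy : y ∈ locus C e) :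
    Sum.elim t y ∈ locus C (Sum.elim t e) := by
  intro f hf
  have h1 : ∀ w : σ → K, MvPolynomial.aeval (Sum.elim t w) f =
      MvPolynomial.eval₂Hom (MvPolynomial.aeval (R := C) w : MvPolynomial σ C →ₐ[C] K).toRingHom t
        (MvPolynomial.sumRingEquiv C σ' σ f) := by
    intro w
    have : (MvPolynomial.aeval (R := C) (Sum.elim t w)).toRingHom =
        (MvPolynomial.eval₂Hom (MvPolynomial.aeval (R := C) w).toRingHom t).comp
          (MvPolynomial.sumRingEquiv C σ' σ : _ →+* MvPolynomial σ' (MvPolynomial σ C)) := by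
      refine MvPolynomial.ringHom_ext (fun r => ?_) fun i => ?_
      · simp
      · rcases i with i | i <;> simp
    exact congrArg (fun g => g f) this
  rw [h1] at hf ⊢
  generalize MvPolynomial.sumRingEquiv C σ' σ f = g at hf ⊢
  let e' : σ → IntermediateField.adjoin C (Set.range e) := fun i =>
    ⟨e i, IntermediateField.subset_adjoin _ _ ⟨i, rfl⟩⟩
  have hcomp : (algebraMap (IntermediateField.adjoin C (Set.range e)) K).comp
      (MvPolynomial.aeval (R := C) e').toRingHom = (MvPolynomial.aeval (R := C) e).toRingHom := by
    refine MvPolynomial.ringHom_ext (fun r => ?_) fun i => ?_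
    · simp
    · simp [e']
  have h2 : MvPolynomial.map (MvPolynomial.aeval (R := C) e').toRingHom g = 0 := by
    refine (map_eq_zero_iff _ ht).1 ?_
    rw [MvPolynomial.aeval_def, MvPolynomial.eval₂_map, hcomp]
    exact hf
  have h3 : MvPolynomial.map (MvPolynomial.aeval (R := C) y).toRingHom g = 0 := by
    ext m
    rw [MvPolynomial.coeff_map, MvPolynomial.coeff_zero]
    refine hy _ ?_
    have h4 := congrArg (MvPolynomial.coeff m) h2
    rw [MvPolynomial.coeff_map, MvPolynomial.coeff_zero] at h4
    have h5 := congrArg (algebraMap (IntermediateField.adjoin C (Set.range e)) K) h4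
    rw [← RingHom.comp_apply, hcomp, map_zero] at h5
    exact h5
  rw [MvPolynomial.coe_eval₂Hom, MvPolynomial.eval₂_eq_eval_map, h3, map_zero]

/-- Let `m` specialize the minimal polynomial of `s` over a field that contains the coefficients.
Polynomials that vanish at `s` specialize to polynomials that vanish at every root of the
specialization of `m`: this is division with remainder by `m`. -/
theorem eval₂_eq_zero_of_specialization {A L : Type*} [CommRing A] [Field L] [Algebra L K]
    {j : A →+* L} {ψ : A →+* K} (hjψ : ∀ x, j x = 0 → ψ x = 0) {s s' : K}
    {m : Polynomial A} (hm : m.Monic) (hms : m.map j = minpoly L s)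
    (hs' : m.eval₂ ψ s' = 0) {x : Polynomial A}
    (hx : x.eval₂ ((algebraMap L K).comp j) s = 0) : x.eval₂ ψ s' = 0 := by
  have hj : ∀ f : Polynomial A, f.eval₂ ((algebraMap L K).comp j) s =
      Polynomial.aeval s (f.map j) := fun f => by
    rw [Polynomial.aeval_def, Polynomial.eval₂_map]
  have hdiv := Polynomial.modByMonic_add_div x m
  have h1 : (x %ₘ m).map j = 0 := by
    by_contra h0
    have h2 : Polynomial.aeval s ((x %ₘ m).map j) = 0 := by
      have h3 := congrArg (fun f => Polynomial.aeval s (Polynomial.map j f)) hdiv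
      simp only [Polynomial.map_add, Polynomial.map_mul, map_add, map_mul, hms, minpoly.aeval,
        zero_mul, add_zero] at h3
      rw [h3, ← hj, hx]
    have h3 := minpoly.degree_le_of_ne_zero L s h0 h2
    rw [← hms, hm.degree_map j] at h3
    have : Nontrivial A := j.domain_nontrivial
    exact absurd (h3.trans Polynomial.degree_map_le)
      (not_le.2 (Polynomial.degree_modByMonic_lt x hm))
  rw [← hdiv, Polynomial.eval₂_add, Polynomial.eval₂_mul, hs', zero_mul, add_zero]
  have h4 : (x %ₘ m).map ψ = 0 := by
    ext i
    rw [Polynomial.coeff_map, Polynomial.coeff_zero]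
    refine hjψ _ ?_
    rw [← Polynomial.coeff_map, h1, Polynomial.coeff_zero]
  rw [Polynomial.eval₂_eq_eval_map, h4, Polynomial.eval_zero]

theorem exists_common_denominator (v : σ → K)
    (T : Finset (IntermediateField.adjoin C (Set.range v))) :
    ∃ D : MvPolynomial σ C, MvPolynomial.aeval v D ≠ 0 ∧ ∀ x ∈ T, ∃ P : MvPolynomial σ C,
      MvPolynomial.aeval v D * (x : K) = MvPolynomial.aeval v P := by
  classical
  induction T using Finset.induction_on with
  | empty => exact ⟨1, by simp, by simp⟩
  | insert x T _ ih =>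
    obtain ⟨D, hD, hT⟩ := ih
    obtain ⟨r, s, hrs⟩ := (IntermediateField.mem_adjoin_range_iff C v (x : K)).1 x.2
    by_cases hs : MvPolynomial.aeval v s = 0
    · refine ⟨D, hD, fun y hy => ?_⟩
      rcases Finset.mem_insert.1 hy with rfl | hy
      · exact ⟨0, by rw [hrs, hs]; simp⟩
      · exact hT y hy
    · refine ⟨D * s, by rw [map_mul]; exact mul_ne_zero hD hs, fun y hy => ?_⟩
      rcases Finset.mem_insert.1 hy with rfl | hy
      · refine ⟨D * r, ?_⟩
        rw [hrs, map_mul, map_mul]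
        field_simp
      · obtain ⟨P, hP⟩ := hT y hy
        refine ⟨P * s, ?_⟩
        rw [map_mul, map_mul, ← hP]
        ring

/-- The multiple by `D` of a polynomial over `C(v)` with denominators dividing `D`, with its
coefficients written as polynomials in the generic point `v`. -/
theorem exists_polynomial_lift {v : σ → K} {D : MvPolynomial σ C}
    (f : Polynomial (IntermediateField.adjoin C (Set.range v)))
    (hf : ∀ x ∈ f.coeffs, ∃ P : MvPolynomial σ C,
      MvPolynomial.aeval v D * (x : K) = MvPolynomial.aeval v P) :
    ∃ g : Polynomial (MvPolynomial σ C), g.degree ≤ f.degree ∧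
      ∀ i, MvPolynomial.aeval v (g.coeff i) = MvPolynomial.aeval v D * (f.coeff i : K) := by
  have h : ∀ i ∈ f.support, ∃ P : MvPolynomial σ C,
      MvPolynomial.aeval v D * (f.coeff i : K) = MvPolynomial.aeval v P := fun i hi =>
    hf _ (Polynomial.coeff_mem_coeffs (Polynomial.mem_support_iff.1 hi))
  choose! P hP using h
  have hcoeff : ∀ i, (∑ k ∈ f.support, Polynomial.monomial k (P k)).coeff i =
      if i ∈ f.support then P i else 0 := by
    intro i
    simp [Polynomial.finsetSum_coeff, Polynomial.coeff_monomial]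
  refine ⟨∑ k ∈ f.support, Polynomial.monomial k (P k), ?_, fun i => ?_⟩
  · refine (Polynomial.degree_le_iff_coeff_zero _ _).2 fun i hi => ?_
    rw [hcoeff, if_neg]
    rw [Polynomial.notMem_support_iff]
    exact Polynomial.coeff_eq_zero_of_degree_lt hi
  · rw [hcoeff]
    split_ifs with hi
    · exact (hP i hi).symm
    · rw [Polynomial.notMem_support_iff.1 hi]
      simp

theorem continuous_aeval_mvPolynomial [TopologicalSpace K] [IsTopologicalRing K]
    (f : MvPolynomial σ C) : Continuous fun w : σ → K => MvPolynomial.aeval w f := by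
  induction f using MvPolynomial.induction_on with
  | C a => simpa using continuous_const
  | add f g hf hg => simpa using! hf.add hg
  | mul_X f i hf => simpa using! hf.mul (continuous_apply i)

theorem exists_primitive_element_of_forall_isSeparable {L : Type*} [Field L] [Algebra L K]
    {κ : Type*} [Finite κ] {u : κ → K} (hu : ∀ j, IsSeparable L (u j)) :
    ∃ s : K, IsSeparable L s ∧ ∀ j, ∃ r : Polynomial L, Polynomial.aeval s r = u j := by
  let M := IntermediateField.adjoin L (Set.range u)
  have : Algebra.IsSeparable L M := (IntermediateField.isSeparable_adjoin_iff_isSeparable L K).2 (by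
    rintro _ ⟨j, rfl⟩
    exact hu j)
  have : FiniteDimensional L M := IntermediateField.finiteDimensional_adjoin (by
    rintro _ ⟨j, rfl⟩
    exact (hu j).isIntegral)
  let pb := Field.powerBasisOfFiniteOfSeparable L M
  refine ⟨pb.gen, ?_, fun j => ?_⟩
  · exact (Algebra.IsSeparable.isSeparable L pb.gen).map M.val M.val.injective
  · obtain ⟨r, hr⟩ := pb.exists_eq_aeval'
      (⟨u j, IntermediateField.subset_adjoin _ _ ⟨j, rfl⟩⟩ : M)
    refine ⟨r, ?_⟩
    have h1 := congrArg M.val hr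
    rw [← Polynomial.aeval_algHom_apply] at h1
    exact h1.symm

/-- Substituting the univariate polynomials `ρ` for some of the variables and then evaluating at `s`
is the same as evaluating at the values of `ρ` at `s`. -/
theorem eval₂_eval₂_eq_aeval {A τ : Type*} [CommRing A] {α : MvPolynomial σ C →+* A} {θ : A →+* K}
    {w : σ → K} (hθ : ∀ f, θ (α f) = MvPolynomial.aeval w f) (s : K) (ρ : τ → Polynomial A)
    (f : MvPolynomial (σ ⊕ τ) C) :
    (f.eval₂ (Polynomial.C.comp (α.comp MvPolynomial.C))
      (Sum.elim (fun i => Polynomial.C (α (MvPolynomial.X i))) ρ)).eval₂ θ s =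
    MvPolynomial.aeval (Sum.elim w fun k => (ρ k).eval₂ θ s) f := by
  rw [← Polynomial.coe_eval₂RingHom, MvPolynomial.eval₂_comp_left, MvPolynomial.aeval_def]
  congr 1
  · ext c
    simp [hθ]
  · funext i
    rcases i with i | i <;> simp [hθ]

/-- Finitely many elements `u` that are separable algebraic over `C(v)` may be specialized along
with `v`, as long as `v` moves little in a henselian topology: a primitive element moves to a root
of the specialization of its minimal polynomial. -/
theorem IsHenselianTopology.eventually_exists_mem_locus {τ : TopologicalSpace K}
    (hτ : IsHenselianTopology K τ) {v : σ → K} {κ : Type*} [Finite κ]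
    {u : κ → K}
    (hu : ∀ j, IsSeparable (IntermediateField.adjoin C (Set.range v)) (u j)) :
    ∀ᶠ w in 𝓝 v, w ∈ locus C v → ∃ z : κ → K, Sum.elim w z ∈ locus C (Sum.elim v u) := by
  classical
  have := hτ.1
  have := Fintype.ofFinite κ
  set L := IntermediateField.adjoin C (Set.range v) with hL
  obtain ⟨s, hs, hr⟩ := exists_primitive_element_of_forall_isSeparable hu
  choose r hr using hr
  set μ := minpoly L s with hμ
  have hμm : μ.Monic := minpoly.monic hs.isIntegral
  obtain ⟨D, hD, hT⟩ := exists_common_denominator v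
    (μ.eraseLead.coeffs ∪ Finset.univ.biUnion fun j => (r j).coeffs)
  obtain ⟨g, hgdeg, hg⟩ := exists_polynomial_lift μ.eraseLead
    fun x hx => hT x (Finset.mem_union_left _ hx)
  choose r' _ hr' using fun j => exists_polynomial_lift (D := D) (r j)
    fun x hx => hT x (Finset.mem_union_right _ (Finset.mem_biUnion.2 ⟨j, Finset.mem_univ _, hx⟩))
  have hgdeg' : g.degree < (μ.natDegree : ℕ) := by
    rw [← Polynomial.degree_eq_natDegree hμm.ne_zero]
    exact hgdeg.trans_lt (Polynomial.degree_eraseLead_lt hμm.ne_zero)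
  have hμeq : Polynomial.X ^ μ.natDegree + μ.eraseLead = μ := by
    conv_rhs => rw [← μ.eraseLead_add_C_mul_X_pow, hμm.leadingCoeff]
    rw [map_one, one_mul, add_comm]
  -- The minimal polynomial of `s` without denominators, over the polynomial ring in the point `v`.
  let q : Polynomial (MvPolynomial σ C) := Polynomial.C D * Polynomial.X ^ μ.natDegree + g
  have hqv : q.map (MvPolynomial.aeval (R := C) v).toRingHom =
      Polynomial.C (MvPolynomial.aeval v D) * μ.map (algebraMap L K) := by
    have h1 : μ.map (algebraMap L K) =
        Polynomial.X ^ μ.natDegree + μ.eraseLead.map (algebraMap L K) := by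
      conv_lhs => rw [← hμeq]
      simp
    rw [h1]
    ext i
    simp only [q, Polynomial.map_add, Polynomial.map_mul, Polynomial.map_C, Polynomial.map_pow,
      Polynomial.map_X, Polynomial.coeff_add, mul_add, Polynomial.coeff_C_mul,
      Polynomial.coeff_map]
    exact congrArg _ (hg i)
  have hroot : ∀ᶠ w in 𝓝 v, ∃ s',
      (q.map (MvPolynomial.aeval (R := C) w).toRingHom).eval s' = 0 := by
    refine hτ.eventually_exists_root (N := q.natDegree) (s := s)
      (fun w => Polynomial.natDegree_map_le) (fun i => ?_) ?_ ?_
    · simp_rw [Polynomial.coeff_map]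
      exact (continuous_aeval_mvPolynomial (q.coeff i)).continuousAt
    · rw [hqv, Polynomial.eval_mul, Polynomial.eval_map_algebraMap, minpoly.aeval, mul_zero]
    · rw [hqv, Polynomial.derivative_C_mul, Polynomial.eval_mul, Polynomial.eval_C,
        Polynomial.derivative_map, Polynomial.eval_map_algebraMap]
      exact mul_ne_zero hD (hs.aeval_derivative_ne_zero (minpoly.aeval L s))
  filter_upwards [hroot, (continuous_aeval_mvPolynomial D).continuousAt.eventually
    (hτ.eventually_ne_zero hD)] with w ⟨s', hs'⟩ hDw hw
  -- With `D` inverted, evaluation at `v` and at `w` extend to `j` and `ψ`, and the minimal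
  -- polynomial lifts to the monic polynomial `m`.
  let A := Localization.Away D
  let α : MvPolynomial σ C →+* A := algebraMap _ _
  let d : A := IsLocalization.Away.invSelf D
  have hd : α D * d = 1 := IsLocalization.Away.mul_invSelf D
  let m : Polynomial A := Polynomial.X ^ μ.natDegree + Polynomial.C d * g.map α
  have hm : m.Monic := by
    refine Polynomial.monic_X_pow_add (lt_of_le_of_lt ?_ hgdeg')
    rw [← Polynomial.smul_eq_C_mul]
    exact (Polynomial.degree_smul_le _ _).trans Polynomial.degree_map_le
  have hmq : Polynomial.C (α D) * m = q.map α := by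
    simp only [m, q, mul_add, Polynomial.map_add, Polynomial.map_mul, Polynomial.map_C,
      Polynomial.map_pow, Polynomial.map_X]
    rw [← mul_assoc, ← map_mul, hd, map_one, one_mul]
  let v' : σ → L := fun i => ⟨v i, IntermediateField.subset_adjoin _ _ ⟨i, rfl⟩⟩
  have hv' : ∀ f : MvPolynomial σ C, ((MvPolynomial.aeval (R := C) v' f : L) : K) =
      MvPolynomial.aeval v f := fun f =>
    (MvPolynomial.aeval_algebraMap_apply K v' f).symm
  have hDv' : MvPolynomial.aeval (R := C) v' D ≠ 0 := fun h0 => hD (by rw [← hv', h0]; rfl)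
  let j : A →+* L := IsLocalization.Away.lift D (g := (MvPolynomial.aeval (R := C) v').toRingHom)
    hDv'.isUnit
  let ψ : A →+* K := IsLocalization.Away.lift D (g := (MvPolynomial.aeval (R := C) w).toRingHom)
    hDw.isUnit
  have hj : ∀ f, j (α f) = MvPolynomial.aeval (R := C) v' f := fun f =>
    IsLocalization.Away.lift_eq _ _ _
  have hψ : ∀ f, ψ (α f) = MvPolynomial.aeval (R := C) w f := fun f =>
    IsLocalization.Away.lift_eq _ _ _
  have hjψ : ∀ x, j x = 0 → ψ x = 0 := by
    intro x hx
    obtain ⟨k, f, hf⟩ := IsLocalization.Away.surj D x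
    have h1 : MvPolynomial.aeval v f = 0 := by
      rw [← hv', ← hj, ← hf, map_mul, hx, zero_mul]
      rfl
    have h2 := congrArg ψ hf
    rw [hψ, hw f h1, map_mul, map_pow, hψ] at h2
    exact (mul_eq_zero.1 h2).resolve_right (pow_ne_zero _ hDw)
  have hjα : ∀ f, (algebraMap L K).comp j (α f) = MvPolynomial.aeval v f := fun f => by
    rw [RingHom.comp_apply, hj]
    exact hv' f
  have hmj : m.map j = μ := by
    refine Polynomial.map_injective _ (algebraMap L K).injective ?_
    refine mul_left_cancel₀ (Polynomial.C_ne_zero.2 hD) ?_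
    rw [← hqv, Polynomial.map_map]
    have h1 := congrArg (Polynomial.map ((algebraMap L K).comp j)) hmq
    rw [Polynomial.map_mul, Polynomial.map_C, hjα, Polynomial.map_map] at h1
    rw [h1]
    congr 1
    exact RingHom.ext hjα
  have hmψ : m.eval₂ ψ s' = 0 := by
    refine (mul_eq_zero.1 ?_).resolve_left hDw
    have h1 := congrArg (Polynomial.eval₂ ψ s') hmq
    rw [Polynomial.eval₂_mul, Polynomial.eval₂_C, hψ, Polynomial.eval₂_map] at h1
    rw [h1, ← hs', Polynomial.eval_map]
    congr 1
    exact RingHom.ext hψ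
  let ρ : κ → Polynomial A := fun k => Polynomial.C d * (r' k).map α
  have hρ : ∀ k, (ρ k).eval₂ ((algebraMap L K).comp j) s = u k := by
    intro k
    refine mul_left_cancel₀ hD ?_
    have h1 : (Polynomial.C (α D) * ρ k) = (r' k).map α := by
      rw [← mul_assoc, ← map_mul, hd, map_one, one_mul]
    have h2 := congrArg (Polynomial.eval₂ ((algebraMap L K).comp j) s) h1
    rw [Polynomial.eval₂_mul, Polynomial.eval₂_C, hjα, Polynomial.eval₂_map] at h2
    rw [h2, Polynomial.eval₂_eq_eval_map, ← hr k, ← Polynomial.eval_map_algebraMap,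
      ← Polynomial.eval_C_mul]
    congr 1
    ext i
    rw [Polynomial.coeff_map, RingHom.comp_apply, hjα, hr', Polynomial.coeff_C_mul,
      Polynomial.coeff_map]
    rfl
  refine ⟨fun k => (ρ k).eval₂ ψ s', fun f hf => ?_⟩
  rw [← eval₂_eval₂_eq_aeval hψ]
  refine eval₂_eq_zero_of_specialization hjψ hm hmj hmψ ?_
  rw [eval₂_eval₂_eq_aeval (w := v) hjα, funext hρ, hf]

end Specialization

/-! ### Quantifier-free formulas -/

section Formula

variable {K : Type u} [Field K] {C : Subfield K} {m n : ℕ}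

/-- Terms with parameters from `C` define polynomial functions over `C`. -/
theorem exists_aeval_eq_realize
    (t : (Language.ring[[((C : Set K) : Type _)]]).Term (Fin m ⊕ Fin n)) :
    letI := FirstOrder.Ring.compatibleRingOfRing K
    ∃ f : MvPolynomial (Fin m ⊕ Fin n) C, ∀ x : Fin m ⊕ Fin n → K,
      t.realize x = MvPolynomial.aeval x f := by
  let := FirstOrder.Ring.compatibleRingOfRing K
  induction t with
  | var i => exact ⟨MvPolynomial.X i, fun x => by simp⟩
  | func F ts ih =>
    choose g hg using ih
    rcases F with F | F
    · cases F with
      | add =>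
        refine ⟨g 0 + g 1, fun x => ?_⟩
        rw [map_add, ← hg, ← hg]
        exact Ring.CompatibleRing.funMap_add (R := K) fun i => (ts i).realize x
      | mul =>
        refine ⟨g 0 * g 1, fun x => ?_⟩
        rw [map_mul, ← hg, ← hg]
        exact Ring.CompatibleRing.funMap_mul (R := K) fun i => (ts i).realize x
      | neg =>
        refine ⟨- g 0, fun x => ?_⟩
        rw [map_neg, ← hg]
        exact Ring.CompatibleRing.funMap_neg (R := K) fun i => (ts i).realize x
      | zero =>
        refine ⟨0, fun x => ?_⟩
        rw [map_zero]
        exact Ring.CompatibleRing.funMap_zero (R := K) fun i => (ts i).realize x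
      | one =>
        refine ⟨1, fun x => ?_⟩
        rw [map_one]
        exact Ring.CompatibleRing.funMap_one (R := K) fun i => (ts i).realize x
    · rename_i l
      rcases l with _ | l
      · refine ⟨MvPolynomial.C (show C from F), fun x => ?_⟩
        rw [MvPolynomial.aeval_C]
        rfl
      · exact isEmptyElim F

/-- The truth of a quantifier-free formula depends only on which of finitely many polynomials
vanish. -/
theorem exists_finset_holdsAt_iff {φ : RingFormulaOver C m n} (hφ : φ.IsQF) :
    ∃ S : Finset (MvPolynomial (Fin m ⊕ Fin n) C), ∀ (a a' : Fin m → K) (b b' : Fin n → K),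
      (∀ f ∈ S, MvPolynomial.aeval (Sum.elim a b) f = 0 ↔
        MvPolynomial.aeval (Sum.elim a' b') f = 0) → (HoldsAt φ a b ↔ HoldsAt φ a' b') := by
  classical
  let := FirstOrder.Ring.compatibleRingOfRing K
  induction hφ with
  | falsum => exact ⟨∅, fun _ _ _ _ _ => Iff.rfl⟩
  | of_isAtomic h =>
    cases h with
    | equal t₁ t₂ =>
      obtain ⟨f₁, hf₁⟩ := exists_aeval_eq_realize t₁
      obtain ⟨f₂, hf₂⟩ := exists_aeval_eq_realize t₂
      refine ⟨{f₁ - f₂}, fun a a' b b' h => ?_⟩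
      have h1 := h _ (Finset.mem_singleton_self _)
      rw [map_sub, map_sub, sub_eq_zero, sub_eq_zero, ← hf₁, ← hf₂, ← hf₁, ← hf₂] at h1
      exact h1
    | rel R ts => rcases R with R | R <;> exact isEmptyElim R
  | imp _ _ ih₁ ih₂ =>
    obtain ⟨S₁, h₁⟩ := ih₁
    obtain ⟨S₂, h₂⟩ := ih₂
    refine ⟨S₁ ∪ S₂, fun a a' b b' h => ?_⟩
    exact imp_congr (h₁ a a' b b' fun f hf => h f (Finset.mem_union_left _ hf))
      (h₂ a a' b b' fun f hf => h f (Finset.mem_union_right _ hf))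

theorem mem_existsSet_iff {φ : RingFormulaOver C m n} {a : Fin m → K} :
    a ∈ existsSet φ ↔ ∃ b, HoldsAt φ a b := by
  let := FirstOrder.Ring.compatibleRingOfRing K
  exact FirstOrder.Language.BoundedFormula.realize_exs

end Formula

/-! ### Existential formulas near a point of a locus -/

section Main

variable {K : Type u} [Field K] {C : Subfield K} {σ : Type*}

theorem isSeparable_adjoin_sumElim {σ' : Type*} {t : σ' → K} {e : σ → K} {x : K}
    (hx : IsSeparable (IntermediateField.adjoin (IntermediateField.adjoin C (Set.range e))
      (Set.range t)) x) :
    IsSeparable (IntermediateField.adjoin C (Set.range (Sum.elim t e))) x := by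
  obtain ⟨f, hf, hf0, hfc⟩ := isSeparable_iff_exists_polynomial.1 hx
  refine isSeparable_iff_exists_polynomial.2 ⟨f, hf, hf0, fun i => ?_⟩
  obtain ⟨⟨y, hy⟩, hi⟩ := hfc i
  rw [← hi]
  refine ⟨⟨y, ?_⟩, rfl⟩
  refine (Subfield.closure_le (t := (IntermediateField.adjoin C
    (Set.range (Sum.elim t e))).toSubfield)).2 ?_ hy
  rintro _ (⟨⟨z, hz⟩, rfl⟩ | ⟨j, rfl⟩)
  · exact IntermediateField.adjoin.mono _ _ _ (by
      rintro _ ⟨j, rfl⟩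
      exact ⟨.inr j, rfl⟩) hz
  · exact IntermediateField.subset_adjoin _ _ ⟨.inl j, rfl⟩

/-- If `b` is separable over `C(e)`, then all points of the locus of `e` that are close to `e`
extend to points that satisfy the same quantifier-free formula as `(e, b)`. -/
theorem IsHenselianTopology.eventually_exists_holdsAt {p : ℕ} [ExpChar K p]
    {τ : TopologicalSpace K} (hτ : IsHenselianTopology K τ) {m n : ℕ} {φ : RingFormulaOver C m n}
    (hφ : φ.IsQF) {e : σ → K} {i : Fin m → σ} {b : Fin n → K}
    (hb : IsSeparableOver p C (Set.range e) b) (h : HoldsAt φ (e ∘ i) b) :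
    ∀ᶠ y in 𝓝 e, y ∈ locus C e → ∃ b', HoldsAt φ (y ∘ i) b' := by
  classical
  obtain ⟨S, hS⟩ := exists_finset_holdsAt_iff hφ
  have : ExpChar (IntermediateField.adjoin C (Set.range e)) p :=
    (algebraMap (IntermediateField.adjoin C (Set.range e)) K).expChar
      (algebraMap (IntermediateField.adjoin C (Set.range e)) K).injective p
  have : Algebra.EssFiniteType (IntermediateField.adjoin C (Set.range e))
      (IntermediateField.adjoin (IntermediateField.adjoin C (Set.range e)) (Set.range b)) :=
    (IntermediateField.essFiniteType_iff).2 (IntermediateField.fg_adjoin_of_finite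
      (Set.finite_range b))
  obtain ⟨r, t, ht, hsep⟩ := (isSeparableExtension_iff.1 hb).exists_separating
  let v : Fin r ⊕ σ → K := Sum.elim t e
  have hbv : ∀ j, b j ∈ separableClosure (IntermediateField.adjoin C (Set.range v)) K := fun j =>
    mem_separableClosure_iff.2 (isSeparable_adjoin_sumElim
      (hsep _ (IntermediateField.subset_adjoin _ _ ⟨j, rfl⟩)))
  have hev : ∀ k, e k ∈ separableClosure (IntermediateField.adjoin C (Set.range v)) K := fun k =>
    IntermediateField.algebraMap_mem _ (⟨e k, IntermediateField.subset_adjoin _ _ ⟨.inr k, rfl⟩⟩ :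
      IntermediateField.adjoin C (Set.range v))
  have hfv : ∀ f : MvPolynomial (Fin m ⊕ Fin n) C, MvPolynomial.aeval (Sum.elim (e ∘ i) b) f ∈
      separableClosure (IntermediateField.adjoin C (Set.range v)) K := by
    intro f
    induction f using MvPolynomial.induction_on with
    | C a =>
      rw [MvPolynomial.aeval_C]
      exact IntermediateField.algebraMap_mem _ (algebraMap C
        (IntermediateField.adjoin C (Set.range v)) a)
    | add f g hf hg =>
      rw [map_add]
      exact add_mem hf hg
    | mul_X f k hf =>
      rw [map_mul, MvPolynomial.aeval_X]
      refine mul_mem hf ?_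
      rcases k with k | k
      exacts [hev _, hbv _]
  -- Inverses of the values of the polynomials in `S` are adjoined to `b`, so that
  -- nonvanishing becomes a polynomial equation, too.
  let u : Fin n ⊕ S → K := Sum.elim b fun f => (MvPolynomial.aeval (Sum.elim (e ∘ i) b) f.1)⁻¹
  have hu : ∀ j, IsSeparable (IntermediateField.adjoin C (Set.range v)) (u j) := by
    rintro (j | f)
    exacts [mem_separableClosure_iff.1 (hbv j), mem_separableClosure_iff.1 (inv_mem (hfv f.1))]
  have hcont : Continuous fun y : σ → K => (Sum.elim t y : Fin r ⊕ σ → K) := by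
    refine continuous_pi fun k => ?_
    rcases k with k | k
    exacts [continuous_const, continuous_apply k]
  filter_upwards [hcont.continuousAt.eventually (hτ.eventually_exists_mem_locus hu)] with y hy hye
  obtain ⟨z, hz⟩ := hy (sumElim_mem_locus ht hye)
  refine ⟨fun j => z (.inl j), (hS _ _ _ _ fun f hf => ?_).1 h⟩
  let ν : Fin m ⊕ Fin n → (Fin r ⊕ σ) ⊕ (Fin n ⊕ S) :=
    Sum.elim (fun k => .inl (.inr (i k))) fun j => .inr (.inl j)
  have h1 : MvPolynomial.aeval (Sum.elim v u) (MvPolynomial.rename ν f) =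
      MvPolynomial.aeval (Sum.elim (e ∘ i) b) f := by
    rw [MvPolynomial.aeval_rename]
    congr 2
    funext k
    rcases k with k | k <;> rfl
  have h2 : MvPolynomial.aeval (Sum.elim (Sum.elim t y) z) (MvPolynomial.rename ν f) =
      MvPolynomial.aeval (Sum.elim (y ∘ i) fun j => z (.inl j)) f := by
    rw [MvPolynomial.aeval_rename]
    congr 2
    funext k
    rcases k with k | k <;> rfl
  constructor
  · intro h0
    rw [← h2]
    exact hz _ (h1.trans h0)
  · intro h0
    by_contra h3
    have h4 := hz (MvPolynomial.rename ν f * MvPolynomial.X (.inr (.inr ⟨f, hf⟩)) - 1) (by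
      rw [map_sub, map_mul, h1, MvPolynomial.aeval_X, map_one, sub_eq_zero]
      exact mul_inv_cancel₀ h3)
    rw [map_sub, map_mul, h2, h0, zero_mul, map_one, zero_sub, neg_eq_zero] at h4
    exact one_ne_zero h4

end Main

theorem theorem1p2
    {K : Type u} [Field K] (p : ℕ) [ExpChar K p]
    (τ : TopologicalSpace K) (hτ : IsHenselianTopology K τ)
    (C : Subfield K) (hC : IsSeparableExtension p C K)
    {ι : Type*} [LinearOrder ι] [WellFoundedLT ι]
    (c : ι → C) (hc_inj : Function.Injective c) (hc : IsPBasis p (⊥ : Subfield C) (Set.range c))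
    {m n : ℕ} (X : Set (Fin m → K)) (φ : RingFormulaOver C m n)
    (hX : IsExistentiallyDefinedBy X φ)
    (a : Fin m → K) (ha : a ∈ X) :
    (∃ b : Fin n → K, HoldsAt φ a b) ∧
    ∀ b : Fin n → K, HoldsAt φ a b →
      ∃ U ∈ 𝓝 (lambdaTuple p c b a),
        lambdaProj p c b a '' (locus C (lambdaTuple p c b a) ∩ U) ⊆ X := by
  obtain ⟨hφ, rfl⟩ := hX
  refine ⟨mem_existsSet_iff.1 ha, fun b hb => ?_⟩
  have hsep : IsSeparableOver p C (Set.range (lambdaTuple p c b a)) b := by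
    have hr : Set.range (lambdaTuple p c b a) = lambdaSet p c b a := Subtype.range_coe
    rw [hr]
    -- The infimum is that of a nonempty set, so it is attained.
    exact Nat.sInf_mem (exists_isSeparableOver_lambdaStage hC hc_inj hc (List.ofFn a) b)
  let i : Fin m → lambdaSet p c b a := fun k => ⟨a k, mem_lambdaSet p c b a k⟩
  refine ⟨_, hτ.eventually_exists_holdsAt (i := i) hφ hsep hb, ?_⟩
  rintro _ ⟨y, ⟨hy, hyU⟩, rfl⟩
  exact mem_existsSet_iff.2 (hyU hy)
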